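/- For positive integers $n,q$ let $\mathfrak M_{n,q}$ be the space of real $n\times q$ matrices $x=(x_{i,j})$ with the Lebesgue measure $dx=\prod_{i=1}^n\prod_{j=1}^q dx_{i,j}$, and for $x\in\mathfrak M_{n,q}$ put $|x|_q=\det(x^Tx)^{1/2}$. For $1\le q\le n$ put $$\sigma_{n,q}=\frac{2^q\pi^{nq/2}}{\Gamma_q(n/2)},\qquad \Gamma_q(\alpha)=\int_{\mathcal P_q} e^{-\operatorname{tr} r}\,|\det r|^{\alpha-(q+1)/2}\,dr ,$$ where $\mathcal P_q$ is the cone of positive definite real symmetric $q\times q$ matrices $r=(r_{i,j})$ and $dr=\prod_{i\le j}dr_{i,j}$ ($\Gamma_q$ is the Siegel gamma function, and $\sigma_{n,q}$ is the total mass to which the invariant measure on the Stiefel manifold $\{v\in\mathfrak M_{n,q}: v^Tv=I_q\}$ is normalized). Let $G_{n,k}$ be the Grassmann manifold of $k$-dimensional linear subspaces of $\mathbb R^n$ and $d\xi$ the $O(n)$-invariant Borel probability measure on it. For $\xi\in G_{n,k}$, write elements of $\xi^q$ as matrices $x=(x_1,\dots,x_q)\in\mathfrak M_{n,q}$ with columns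 $x_j\in\xi$, and let $d_\xi x=d_\xi x_1\cdots d_\xi x_q$, where $d_\xi x_j$ is the Lebesgue measure on the Euclidean space $\xi$. **Theorem.** Let $1\le q\le k\le n$ and let $F\in L^1(\mathfrak M_{n,q})$ be real- or complex-valued. Then for almost every $\xi\in G_{n,k}$ the function $x\mapsto F(x)\,|x|_q^{n-k}$ is integrable on $\xi^q$, the function $\xi\mapsto\int_{\xi^q}F(x)\,|x|_q^{n-k}\,d_\xi x$ is integrable on $G_{n,k}$, and $$\int_{\mathfrak M_{n,q}}F(x)\,dx=\frac{\sigma_{n,q}}{\sigma_{k,q}}\int_{G_{n,k}}d\xi\int_{\xi^q}F(x)\,|x|_q^{n-k}\,d_\xi x .$$ -/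

import Mathlib

open MeasureTheory

noncomputable section

namespace BlaschkePetkantschin

/-! ### Spaces of real matrices -/

/-- The product (equivalently, Borel) sigma-algebra on real matrices. -/
instance instMeasurableSpaceMatrix {ι κ : Type*} : MeasurableSpace (Matrix ι κ ℝ) :=
  inferInstanceAs (MeasurableSpace (ι → κ → ℝ))

instance instBorelSpaceMatrix {ι κ : Type*} [Countable ι] [Countable κ] :
    BorelSpace (Matrix ι κ ℝ) :=
  inferInstanceAs (BorelSpace (ι → κ → ℝ))

/-- The elementary volume `dx = ∏ i, ∏ j, dx i j` on real matrices. -/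
instance instMeasureSpaceMatrix {ι κ : Type*} [Fintype ι] [Fintype κ] :
    MeasureSpace (Matrix ι κ ℝ) where
  volume := (volume : Measure (ι → κ → ℝ))

/-- `|x|_q = det (xᵀ x) ^ (1/2)`. -/
def gramVolume {n q : ℕ} (x : Matrix (Fin n) (Fin q) ℝ) : ℝ :=
  Real.sqrt (x.transpose * x).det

/-- The `n × q` matrix with prescribed columns `y 0, …, y (q-1)`. -/
def ofColumns {n q : ℕ} (y : Fin q → EuclideanSpace ℝ (Fin n)) : Matrix (Fin n) (Fin q) ℝ :=
  Matrix.of fun i j => y j i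

/-! ### The Siegel gamma function and the constants `σ` -/

/-- The symmetric matrix whose entries in positions `(i, j)` and `(j, i)` are the coordinate
`s` of the unordered pair `{i, j}`. Lebesgue measure on `Sym2 (Fin q) → ℝ` thus is the
volume element `∏_{i ≤ j} ds_{i,j}` on symmetric matrices. -/
def symmMatrix {q : ℕ} (s : Sym2 (Fin q) → ℝ) : Matrix (Fin q) (Fin q) ℝ :=
  Matrix.of fun i j => s s(i, j)

/-- The Siegel gamma function
`Γ_q(α) = ∫ exp (- tr r) |det r| ^ (α - (q + 1) / 2) dr`, over positive definite `r`. -/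
def siegelGamma (q : ℕ) (α : ℝ) : ℝ :=
  ∫ s in {s : Sym2 (Fin q) → ℝ | (symmMatrix s).PosDef},
    Real.exp (-(symmMatrix s).trace) * |(symmMatrix s).det| ^ (α - ((q : ℝ) + 1) / 2)

/-- `σ_{n,q} = 2 ^ q π ^ (n q / 2) / Γ_q(n / 2)`. -/
def stiefelVolume (n q : ℕ) : ℝ :=
  2 ^ q * Real.pi ^ ((n : ℝ) * (q : ℝ) / 2) / siegelGamma q ((n : ℝ) / 2)

/-! ### The Grassmann manifold and its invariant probability measure -/

/-- The set `G_{n,k}` of `k`-dimensional linear subspaces of `ℝⁿ`. -/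
def Grassmannian (n k : ℕ) : Type :=
  {ξ : Submodule ℝ (EuclideanSpace ℝ (Fin n)) // Module.finrank ℝ ξ = k}

/-- The usual topology: subspaces are close when their orthogonal projections are. -/
instance instTopologicalSpaceGrassmannian (n k : ℕ) : TopologicalSpace (Grassmannian n k) :=
  TopologicalSpace.induced (fun ξ => ξ.1.starProjection) inferInstance

instance instMeasurableSpaceGrassmannian (n k : ℕ) : MeasurableSpace (Grassmannian n k) :=
  borel _

instance instBorelSpaceGrassmannian (n k : ℕ) : BorelSpace (Grassmannian n k) := ⟨rfl⟩

/-- The orthogonal group `O(n)`, as a group of matrices. -/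
abbrev O (n : ℕ) := Matrix.orthogonalGroup (Fin n) ℝ

/-- The linear isometry `x ↦ g x` of `ℝⁿ` given by an orthogonal matrix `g`. -/
def toIsometry {n : ℕ} : O n →* (EuclideanSpace ℝ (Fin n) ≃ₗᵢ[ℝ] EuclideanSpace ℝ (Fin n)) :=
  Unitary.linearIsometryEquiv.toMonoidHom.comp
    (Unitary.map
      { toFun := Matrix.toEuclideanCLM (n := Fin n) (𝕜 := ℝ)
        map_one' := map_one _
        map_mul' := map_mul _
        map_star' := map_star _ }).toMonoidHom

theorem toIsometry_apply {n : ℕ} (g : O n) (x : EuclideanSpace ℝ (Fin n)) :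
    toIsometry g x = WithLp.toLp 2 (g.1.mulVec x) := rfl

/-- `O(n)` acts on `G_{n,k}` by taking images of subspaces. -/
instance instMulActionGrassmannian (n k : ℕ) : MulAction (O n) (Grassmannian n k) where
  smul g ξ := ⟨ξ.1.map ((toIsometry g).toLinearEquiv :
      EuclideanSpace ℝ (Fin n) →ₗ[ℝ] EuclideanSpace ℝ (Fin n)), by
    rw [LinearEquiv.finrank_map_eq]; exact ξ.2⟩
  one_smul ξ := Subtype.ext (by
    ext x
    constructor
    · rintro ⟨y, hy, rfl⟩
      simpa using hy
    · intro hx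
      exact ⟨x, hx, by simp⟩)
  mul_smul g h ξ := Subtype.ext (by
    ext x
    constructor
    · rintro ⟨y, hy, rfl⟩
      exact ⟨toIsometry h y, ⟨y, hy, rfl⟩, by simp⟩
    · rintro ⟨_, ⟨y, hy, rfl⟩, rfl⟩
      exact ⟨y, hy, by simp⟩)

/-- The coordinate subspace spanned by the first `k` standard basis vectors. -/
def coordPlane {n k : ℕ} (hk : k ≤ n) : Grassmannian n k :=
  ⟨Submodule.span ℝ (Set.range fun j : Fin k =>
      EuclideanSpace.single (Fin.castLE hk j) (1 : ℝ)), by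
    have h : LinearIndependent ℝ fun j : Fin k =>
        (EuclideanSpace.single (Fin.castLE hk j) (1 : ℝ) : EuclideanSpace ℝ (Fin n)) := by
      have := ((EuclideanSpace.basisFun (Fin n) ℝ).orthonormal.linearIndependent).comp
        (Fin.castLE hk) (Fin.castLE_injective hk)
      simpa [Function.comp_def] using this
    rw [finrank_span_eq_card h, Fintype.card_fin]⟩

instance instCompactSpaceO (n : ℕ) : CompactSpace (O n) := by
  suffices hs : IsCompact (O n : Set (Matrix (Fin n) (Fin n) ℝ)) from
    isCompact_iff_compactSpace.mp hs
  have hK : IsCompact (Set.univ.pi fun _ : Fin n => Set.univ.pi fun _ : Fin n =>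
      Metric.closedBall (0 : ℝ) 1) :=
    isCompact_univ_pi fun _ => isCompact_univ_pi fun _ => isCompact_closedBall 0 1
  refine IsCompact.of_isClosed_subset hK
    (isClosed_unitary (R := Matrix (Fin n) (Fin n) ℝ)) ?_
  intro U hU i _ j _
  simpa using entry_norm_bound_of_unitary (𝕜 := ℝ) hU i j

instance instBorelSpaceO (n : ℕ) : BorelSpace (O n) := Subtype.borelSpace _

/-- The `O(n)`-invariant probability measure on `G_{n,k}`: the distribution of `g ξ₀` for
a Haar-distributed `g` in `O(n)`. -/
def grassmannMeasure {n k : ℕ} (hk : k ≤ n) : Measure (Grassmannian n k) :=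
  (Measure.haarMeasure (⊤ : TopologicalSpace.PositiveCompacts (O n))).map
    fun g => g • coordPlane hk

theorem starProjection_smul {n k : ℕ} (g : O n) (ξ : Grassmannian n k) :
    (g • ξ).1.starProjection = (Matrix.toEuclideanCLM (n := Fin n) (𝕜 := ℝ) g.1).comp
      (ξ.1.starProjection.comp (Matrix.toEuclideanCLM (n := Fin n) (𝕜 := ℝ) (g⁻¹).1)) := by
  ext1 x
  have h := Submodule.starProjection_map_apply (toIsometry g) ξ.1 x
  have h2 : (toIsometry g).symm x = toIsometry g⁻¹ x := by rw [map_inv]; rfl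
  rw [h2] at h
  exact h

instance instContinuousSMulGrassmannian (n k : ℕ) :
    ContinuousSMul (O n) (Grassmannian n k) where
  continuous_smul := by
    rw [continuous_induced_rng]
    have hc : Continuous (Matrix.toEuclideanCLM (n := Fin n) (𝕜 := ℝ)) :=
      LinearMap.continuous_of_finiteDimensional
        (Matrix.toEuclideanCLM (n := Fin n) (𝕜 := ℝ)).toAlgEquiv.toLinearMap
    have hp : Continuous fun ξ : Grassmannian n k => ξ.1.starProjection :=
      continuous_induced_dom
    have h1 : Continuous fun p : O n × Grassmannian n k =>
        Matrix.toEuclideanCLM (n := Fin n) (𝕜 := ℝ) p.1.1 :=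
      hc.comp (continuous_subtype_val.comp continuous_fst)
    have h2 : Continuous fun p : O n × Grassmannian n k =>
        Matrix.toEuclideanCLM (n := Fin n) (𝕜 := ℝ) (p.1⁻¹).1 :=
      hc.comp (continuous_subtype_val.comp (continuous_inv.comp continuous_fst))
    refine (h1.clm_comp ((hp.comp continuous_snd).clm_comp h2)).congr fun p => ?_
    exact (starProjection_smul p.1 p.2).symm

theorem measurable_smul_coordPlane {n k : ℕ} (hk : k ≤ n) :
    Measurable fun g : O n => g • coordPlane hk :=
  (continuous_id.smul continuous_const).measurable

instance instIsProbabilityMeasureGrassmann {n k : ℕ} (hk : k ≤ n) :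
    IsProbabilityMeasure (grassmannMeasure hk) := by
  have : IsProbabilityMeasure
      (Measure.haarMeasure (⊤ : TopologicalSpace.PositiveCompacts (O n))) :=
    ⟨Measure.haarMeasure_self (K₀ := ⊤)⟩
  exact Measure.isProbabilityMeasure_map (measurable_smul_coordPlane hk).aemeasurable

/-- Invariance under `O(n)`. -/
theorem grassmannMeasure_map_smul {n k : ℕ} (hk : k ≤ n) (g : O n) :
    (grassmannMeasure hk).map (fun ξ => g • ξ) = grassmannMeasure hk := by
  have hg : Measurable fun ξ : Grassmannian n k => g • ξ :=
    (continuous_const_smul g).measurable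
  have hl : Measurable fun h : O n => g * h := (continuous_const_mul g).measurable
  unfold grassmannMeasure
  rw [Measure.map_map hg (measurable_smul_coordPlane hk)]
  conv_rhs => rw [← map_mul_left_eq_self
    (Measure.haarMeasure (⊤ : TopologicalSpace.PositiveCompacts (O n))) g]
  rw [Measure.map_map (measurable_smul_coordPlane hk) hl]
  congr 1
  funext h
  simp [Function.comp, mul_smul]

end BlaschkePetkantschin

end

open BlaschkePetkantschin

/-!
The Blaschke–Petkantschin formula is proved by comparing invariant measures instead of computing
Jacobians in local coordinates.

The measure `|x|_q ^ (-n) dx` on `n × q` matrices is invariant under `x ↦ g x A` for `g ∈ O(n)`,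
`A ∈ GL_q`, and these substitutions act transitively on the matrices of full column rank, which are
almost all matrices. Integration against it is therefore, up to a constant `c_n`, the same as
integration over `O(n) × GL_q` in the polar coordinates `x = g (I_q; 0) A`
(`exists_invariantVolume_eq_polar`). The uniqueness of invariant measures behind this is the
Tonelli argument `exists_eq_smul_map_of_transitive`.

An invariant random `k`-plane is `g (ℝᵏ × 0)` with `g` Haar distributed in `O(n)`. Hence the right
side of the formula is an integral over `g ∈ O(n)` and `k × q` matrices `y` of
`F (g (I_k; 0) y) |y|_q ^ (n - k)`. Polar coordinates for `y` and the invariance of Haar measure on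
`O(n)` turn it into the polar integral of `F`, so the two sides agree up to `c_n / c_k`
(`exists_lintegral_rotated_frame`).

The constants are found by testing on the Gaussian `exp (- tr (xᵀ x))`. Its integral is a power of
`π` on one side, and on the other `c_n` times a moment of the Gaussian over `GL_q`. The same
uniqueness argument on the cone of positive definite matrices, where `A` acts by `r ↦ Aᵀ r A`
with Jacobian `(det A) ^ (q + 1)` (`det_symmCongr`), shows that this moment is a multiple of
`Γ_q(n / 2)`, with a factor independent of `n` (`exists_lintegral_symmGaussian`,
`siegelGamma_eq_toReal`).

Finally `fiberKernel` packages the measures `|x|_q ^ (n - k) d_ξ x` as a kernel on the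
Grassmannian. Its measurability is checked after composition with the surjection `O(n) → G_{n,k}`
of standard Borel spaces. Then Lebesgue measure is a multiple of the composition of the
Grassmann measure with this kernel (`exists_volume_eq_smul_comp`), and the assertions about
integrable `F` follow.
-/

namespace BlaschkePetkantschin

open scoped ENNReal Matrix

noncomputable section

/-! ### Lebesgue measure on matrices and linear substitutions -/

section Lebesgue

variable {ι κ : Type*} [Fintype ι] [Fintype κ]

instance : SigmaFinite (volume : Measure (Matrix ι κ ℝ)) :=
  inferInstanceAs (SigmaFinite (volume : Measure (ι → κ → ℝ)))

instance : (volume : Measure (Matrix ι κ ℝ)).IsAddHaarMeasure :=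
  have : (volume : Measure (κ → ℝ)).IsAddHaarMeasure := inferInstance
  Measure.pi.isAddHaarMeasure fun _ : ι => (volume : Measure (κ → ℝ))

instance : SecondCountableTopology (Matrix ι κ ℝ) :=
  inferInstanceAs (SecondCountableTopology (ι → κ → ℝ))

instance : LocallyCompactSpace (Matrix ι κ ℝ) :=
  inferInstanceAs (LocallyCompactSpace (ι → κ → ℝ))

theorem volume_unitCube :
    volume {x : Matrix ι κ ℝ | ∀ i j, x i j ∈ Set.Icc (0 : ℝ) 1} = 1 := by
  have h : {x : Matrix ι κ ℝ | ∀ i j, x i j ∈ Set.Icc (0 : ℝ) 1} =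
      (Set.univ.pi fun _ : ι => Set.univ.pi fun _ : κ => Set.Icc (0 : ℝ) 1 : Set (ι → κ → ℝ)) := by
    ext x
    exact ⟨fun hx i _ j _ => hx i j, fun hx i j => hx i trivial j trivial⟩
  rw [h]
  change (volume : Measure (ι → κ → ℝ)) _ = 1
  simp only [volume_pi_pi, Real.volume_Icc, sub_zero, ENNReal.ofReal_one, Finset.prod_const_one]

/-- The image of Lebesgue measure under transposition is a Haar measure, normalized by the unit
cube. -/
theorem measurePreserving_transpose :
    MeasurePreserving (Matrix.transpose : Matrix ι κ ℝ → Matrix κ ι ℝ) := by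
  have hc : Continuous (Matrix.transpose : Matrix ι κ ℝ → Matrix κ ι ℝ) :=
    Continuous.matrix_transpose continuous_id
  refine ⟨hc.measurable, ?_⟩
  let e : Matrix ι κ ℝ ≃L[ℝ] Matrix κ ι ℝ :=
    { Matrix.transposeLinearEquiv ι κ ℝ ℝ with
      continuous_toFun := hc
      continuous_invFun := Continuous.matrix_transpose continuous_id }
  have hH : (Measure.map (Matrix.transpose : Matrix ι κ ℝ → Matrix κ ι ℝ)
      volume).IsAddHaarMeasure :=
    e.isAddHaarMeasure_map volume
  have h := Measure.isAddLeftInvariant_eq_smul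
    (Measure.map (Matrix.transpose : Matrix ι κ ℝ → Matrix κ ι ℝ) volume) volume
  have hm : MeasurableSet {x : Matrix κ ι ℝ | ∀ i j, x i j ∈ Set.Icc (0 : ℝ) 1} := by
    simp only [Set.ofPred_forall]
    exact MeasurableSet.iInter fun i => MeasurableSet.iInter fun j =>
      measurableSet_Icc.preimage
        ((measurable_pi_apply j).comp (measurable_pi_apply (X := fun _ => ι → ℝ) i))
  have h1 := congrArg (fun μ => μ {x : Matrix κ ι ℝ | ∀ i j, x i j ∈ Set.Icc (0 : ℝ) 1}) h
  have hs : (Matrix.transpose : Matrix ι κ ℝ → Matrix κ ι ℝ) ⁻¹'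
      {x : Matrix κ ι ℝ | ∀ i j, x i j ∈ Set.Icc (0 : ℝ) 1} =
      {x : Matrix ι κ ℝ | ∀ i j, x i j ∈ Set.Icc (0 : ℝ) 1} := by
    ext x
    exact forall_comm
  simp only [Measure.map_apply hc.measurable hm, hs, volume_unitCube, Measure.smul_apply] at h1
  rw [h]
  have : (Measure.addHaarScalarFactor
    (Measure.map (Matrix.transpose : Matrix ι κ ℝ → Matrix κ ι ℝ) volume) volume) = 1 := by
    simpa [ENNReal.smul_def] using h1.symm
  rw [this, one_smul]

theorem pi_const_smul {α : Type*} [MeasurableSpace α] (μ : Measure α) [SigmaFinite μ]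
    {c : ℝ≥0∞} (hc : c ≠ ∞) :
    Measure.pi (fun _ : ι => c • μ) = c ^ Fintype.card ι • Measure.pi (fun _ : ι => μ) := by
  lift c to NNReal using hc
  have : SigmaFinite ((c : ℝ≥0∞) • μ) := by
    change SigmaFinite (c • μ)
    infer_instance
  refine (Measure.pi_eq fun s _ => ?_)
  simp [Measure.pi_pi, Finset.prod_mul_distrib]

variable [DecidableEq κ]

theorem map_mul_right_volume {A : Matrix κ κ ℝ} (hA : A.det ≠ 0) :
    Measure.map (fun x : Matrix ι κ ℝ => x * A) volume =
      ENNReal.ofReal |A.det⁻¹| ^ Fintype.card ι • volume := by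
  have hrow := Real.map_matrix_volume_pi_eq_smul_volume_pi (M := Aᵀ) (by simpa using hA)
  rw [Matrix.det_transpose] at hrow
  have : SigmaFinite (Measure.map (Matrix.toLin' Aᵀ) (volume : Measure (κ → ℝ))) := by
    rw [hrow]
    change SigmaFinite ((Real.toNNReal |A.det⁻¹|) • (volume : Measure (κ → ℝ)))
    infer_instance
  have h := Measure.pi_map_pi (ι := ι) (μ := fun _ => (volume : Measure (κ → ℝ)))
    (f := fun _ => Matrix.toLin' Aᵀ) (hμ := fun _ => this)
    fun _ => (LinearMap.continuous_of_finiteDimensional _).aemeasurable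
  rw [hrow, pi_const_smul _ ENNReal.ofReal_ne_top] at h
  refine Eq.trans ?_ h
  congr 1
  funext x i
  simp only [Matrix.toLin'_apply, Matrix.mulVec_transpose]
  rfl

theorem map_mul_left_volume {B : Matrix κ κ ℝ} (hB : B.det ≠ 0) :
    Measure.map (fun x : Matrix κ ι ℝ => B * x) volume =
      ENNReal.ofReal |B.det⁻¹| ^ Fintype.card ι • volume := by
  have hB' : Bᵀ.det ≠ 0 := by simpa using hB
  have h := map_mul_right_volume (ι := ι) hB'
  have hm : Measurable fun x : Matrix ι κ ℝ => x * Bᵀ :=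
    (Continuous.matrix_mul continuous_id continuous_const).measurable
  have hm' : Measurable fun x : Matrix κ ι ℝ => B * x :=
    (Continuous.matrix_mul continuous_const continuous_id).measurable
  have e : (fun x : Matrix κ ι ℝ => B * x) ∘ Matrix.transpose =
      Matrix.transpose ∘ fun x : Matrix ι κ ℝ => x * Bᵀ := by
    funext x
    simp [Matrix.transpose_mul]
  have hT := (measurePreserving_transpose (ι := ι) (κ := κ))
  rw [← hT.map_eq, Measure.map_map hm' hT.measurable, e,
    ← Measure.map_map hT.measurable hm, h, Matrix.det_transpose, Measure.map_smul]

end Lebesgue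

/-! ### Frames, Gram matrices and the polar decomposition -/

/-- The `n × k` matrix `(I_k; 0)`, whose columns are the first `k` standard basis vectors. -/
def standardFrame {n k : ℕ} (hk : k ≤ n) : Matrix (Fin n) (Fin k) ℝ :=
  (1 : Matrix (Fin n) (Fin n) ℝ).submatrix id (Fin.castLE hk)

theorem mul_standardFrame {m n k : ℕ} (hk : k ≤ n) (x : Matrix (Fin m) (Fin n) ℝ) :
    x * standardFrame hk = x.submatrix id (Fin.castLE hk) := by
  have h := Matrix.submatrix_mul x (1 : Matrix (Fin n) (Fin n) ℝ) id id (Fin.castLE hk)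
    Function.bijective_id
  rw [Matrix.mul_one] at h
  rw [h, Matrix.submatrix_id_id, standardFrame]

theorem standardFrame_mul_standardFrame {n k q : ℕ} (hk : k ≤ n) (hq : q ≤ k) :
    standardFrame hk * standardFrame hq = standardFrame (hq.trans hk) := by
  rw [mul_standardFrame]
  rfl

theorem transpose_standardFrame_mul_self {n k : ℕ} (hk : k ≤ n) :
    (standardFrame hk)ᵀ * standardFrame hk = 1 := by
  rw [mul_standardFrame]
  ext i j
  simp [standardFrame, Matrix.one_apply]

theorem orthogonal_transpose_mul {n : ℕ} (g : O n) : g.1ᵀ * g.1 = 1 :=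
  Matrix.mem_unitaryGroup_iff'.mp g.2

theorem orthogonal_inv_mul {n : ℕ} (g : O n) : (g⁻¹).1 * g.1 = 1 := by
  rw [← Submonoid.coe_mul, inv_mul_cancel]
  rfl

theorem gram_orthogonal_mul {n m q : ℕ} (g : O n) (x : Matrix (Fin n) (Fin m) ℝ)
    (A : Matrix (Fin m) (Fin q) ℝ) :
    (g.1 * x * A)ᵀ * (g.1 * x * A) = Aᵀ * (xᵀ * x) * A := by
  calc (g.1 * x * A)ᵀ * (g.1 * x * A) = Aᵀ * (xᵀ * (g.1ᵀ * g.1) * x) * A := by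
        simp only [Matrix.transpose_mul, Matrix.mul_assoc]
    _ = _ := by rw [orthogonal_transpose_mul, Matrix.mul_one]

theorem gram_orthogonal_mul' {n m : ℕ} (g : O n) (x : Matrix (Fin n) (Fin m) ℝ) :
    (g.1 * x)ᵀ * (g.1 * x) = xᵀ * x := by
  simpa using gram_orthogonal_mul g x (1 : Matrix (Fin m) (Fin m) ℝ)

theorem gram_standardFrame_mul {n k q : ℕ} (hk : k ≤ n) (y : Matrix (Fin k) (Fin q) ℝ) :
    (standardFrame hk * y)ᵀ * (standardFrame hk * y) = yᵀ * y := by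
  calc (standardFrame hk * y)ᵀ * (standardFrame hk * y)
      = yᵀ * ((standardFrame hk)ᵀ * standardFrame hk) * y := by
        simp only [Matrix.transpose_mul, Matrix.mul_assoc]
    _ = _ := by rw [transpose_standardFrame_mul_self, Matrix.mul_one]

theorem gramVolume_congr {n m q : ℕ} {x : Matrix (Fin n) (Fin q) ℝ} {y : Matrix (Fin m) (Fin q) ℝ}
    (h : xᵀ * x = yᵀ * y) : gramVolume x = gramVolume y := by
  rw [gramVolume, gramVolume, h]

theorem gramVolume_nonneg {n q : ℕ} (x : Matrix (Fin n) (Fin q) ℝ) : 0 ≤ gramVolume x :=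
  Real.sqrt_nonneg _

theorem gramVolume_square {q : ℕ} (A : Matrix (Fin q) (Fin q) ℝ) : gramVolume A = |A.det| := by
  rw [gramVolume, Matrix.det_mul, Matrix.det_transpose, Real.sqrt_mul_self_eq_abs]

theorem gramVolume_orthogonal_mul {n q : ℕ} (g : O n) (x : Matrix (Fin n) (Fin q) ℝ)
    (A : Matrix (Fin q) (Fin q) ℝ) : gramVolume (g.1 * x * A) = |A.det| * gramVolume x := by
  have h : (Aᵀ * (xᵀ * x) * A).det = A.det ^ 2 * (xᵀ * x).det := by
    rw [Matrix.det_mul, Matrix.det_mul, Matrix.det_transpose]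
    ring
  rw [gramVolume, gramVolume, gram_orthogonal_mul, h, Real.sqrt_mul (sq_nonneg _),
    Real.sqrt_sq_eq_abs]

theorem posDef_gram_iff {n q : ℕ} (x : Matrix (Fin n) (Fin q) ℝ) :
    (xᵀ * x).PosDef ↔ 0 < gramVolume x := by
  constructor
  · exact fun h => Real.sqrt_pos.mpr h.det_pos
  · intro h
    have hp : (xᵀ * x).PosSemidef := by
      simpa using Matrix.posSemidef_conjTranspose_mul_self x
    exact hp.posDef_iff_det_ne_zero.mpr (Real.sqrt_pos.mp h).ne'

theorem exists_transpose_mul_self_eq {q : ℕ} {r : Matrix (Fin q) (Fin q) ℝ} (hr : r.PosDef) :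
    ∃ B : Matrix (Fin q) (Fin q) ℝ, B.det ≠ 0 ∧ r = Bᵀ * B := by
  open scoped MatrixOrder in
  obtain ⟨B, rfl⟩ := CStarAlgebra.nonneg_iff_eq_star_mul_self.mp hr.posSemidef.nonneg
  refine ⟨B, fun h => ?_, ?_⟩
  · have := hr.det_pos
    rw [Matrix.det_mul, h, mul_zero] at this
    exact this.false
  · rw [Matrix.star_eq_conjTranspose, Matrix.conjTranspose_eq_transpose_of_trivial]

/-- `O(n)` acts transitively on orthonormal `k`-frames. -/
theorem exists_orthogonal_mul_standardFrame {n k : ℕ} (hk : k ≤ n) {z : Matrix (Fin n) (Fin k) ℝ}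
    (hz : zᵀ * z = 1) : ∃ g : O n, g.1 * standardFrame hk = z := by
  let v : Fin n → EuclideanSpace ℝ (Fin n) := fun i =>
    if h : (i : ℕ) < k then WithLp.toLp 2 fun r => z r ⟨i, h⟩ else 0
  have hv : Orthonormal ℝ ({i : Fin n | (i : ℕ) < k}.domRestrict v) := by
    rw [orthonormal_iff_ite]
    rintro ⟨i, hi⟩ ⟨j, hj⟩
    have hi' : (i : ℕ) < k := hi
    have hj' : (j : ℕ) < k := hj
    have h := congrFun (congrFun hz ⟨i, hi'⟩) ⟨j, hj'⟩
    simp only [Matrix.mul_apply, Matrix.transpose_apply, Matrix.one_apply, Fin.mk.injEq] at h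
    simp only [Set.domRestrict_apply, v, hi', hj', dif_pos, Subtype.mk.injEq, Fin.ext_iff]
    rw [← h, PiLp.inner_apply]
    simp [mul_comm]
  obtain ⟨b, hb⟩ := hv.exists_orthonormalBasis_extension_of_card_eq (by simp)
  have hg : (Matrix.of fun r i => b i r : Matrix (Fin n) (Fin n) ℝ) ∈
      Matrix.orthogonalGroup (Fin n) ℝ := by
    rw [Matrix.mem_orthogonalGroup_iff']
    ext i j
    have h := orthonormal_iff_ite.mp b.orthonormal i j
    rw [PiLp.inner_apply] at h
    rw [Matrix.one_apply, ← h, Matrix.mul_apply]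
    simp [mul_comm]
  refine ⟨⟨_, hg⟩, ?_⟩
  rw [mul_standardFrame]
  ext r j
  have h := hb (Fin.castLE hk j) (by simp)
  simp [h, v]

/-- Polar decomposition of a matrix of full column rank. -/
theorem exists_polar {n q : ℕ} (hq : q ≤ n) {x : Matrix (Fin n) (Fin q) ℝ}
    (hx : 0 < gramVolume x) : ∃ (g : O n) (B : Matrix (Fin q) (Fin q) ℝ),
      B.det ≠ 0 ∧ x = g.1 * standardFrame hq * B := by
  obtain ⟨B, hB, hxB⟩ := exists_transpose_mul_self_eq ((posDef_gram_iff x).mpr hx)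
  have hu : IsUnit B.det := isUnit_iff_ne_zero.mpr hB
  have hz : (x * B⁻¹)ᵀ * (x * B⁻¹) = 1 := by
    calc (x * B⁻¹)ᵀ * (x * B⁻¹) = B⁻¹ᵀ * (xᵀ * x) * B⁻¹ := by
          simp only [Matrix.transpose_mul, Matrix.mul_assoc]
      _ = (B * B⁻¹)ᵀ * (B * B⁻¹) := by
          rw [hxB]
          simp only [Matrix.transpose_mul, Matrix.mul_assoc]
      _ = 1 := by simp [Matrix.mul_nonsing_inv _ hu]
  obtain ⟨g, hg⟩ := exists_orthogonal_mul_standardFrame hq hz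
  exact ⟨g, B, hB, by rw [hg, Matrix.nonsing_inv_mul_cancel_right _ _ hu]⟩

theorem continuous_gramVolume {n q : ℕ} :
    Continuous (gramVolume : Matrix (Fin n) (Fin q) ℝ → ℝ) :=
  ((continuous_id.matrix_transpose.matrix_mul continuous_id).matrix_det).sqrt

theorem measurable_gramVolume {n q : ℕ} :
    Measurable (gramVolume : Matrix (Fin n) (Fin q) ℝ → ℝ) :=
  continuous_gramVolume.measurable

/-- Almost every `n × q` matrix with `q ≤ n` has full column rank: along every line
`t ↦ x + t (I_q; 0)`, the determinant of the upper `q × q` block is a monic polynomial in `t`. -/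
theorem ae_gramVolume_pos {n q : ℕ} (hq : q ≤ n) :
    ∀ᵐ x : Matrix (Fin n) (Fin q) ℝ, 0 < gramVolume x := by
  let ι := standardFrame hq
  have hcont : Continuous fun p : Matrix (Fin n) (Fin q) ℝ × ℝ => (ιᵀ * (p.1 + p.2 • ι)).det :=
    (continuous_const.matrix_mul
      (continuous_fst.add (continuous_snd.smul continuous_const))).matrix_det
  -- for every `x` almost every `t` is good, so by Tonelli some `t` is good for almost every `x`,
  -- and the translation by `t (I_q; 0)` preserves null sets
  have hline : ∀ᵐ x : Matrix (Fin n) (Fin q) ℝ, ∀ᵐ t : ℝ, (ιᵀ * (x + t • ι)).det ≠ 0 := by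
    refine Filter.Eventually.of_forall fun x => ?_
    have hroots : {t : ℝ | (ιᵀ * (x + t • ι)).det = 0} ⊆
        ((-(ιᵀ * x)).charpoly.roots.toFinset : Set ℝ) := by
      intro t ht
      simp only [Finset.mem_coe, Multiset.mem_toFinset]
      rw [Polynomial.mem_roots (Matrix.charpoly_monic _).ne_zero, Polynomial.IsRoot,
        Matrix.eval_charpoly, ← (show _ = (0 : ℝ) from ht)]
      congr 1
      rw [Matrix.mul_add, Matrix.mul_smul, transpose_standardFrame_mul_self, sub_neg_eq_add,
        add_comm, Matrix.scalar_apply, Matrix.smul_one_eq_diagonal]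
    refine measure_mono_null ?_ ((Finset.finite_toSet
      (-(ιᵀ * x)).charpoly.roots.toFinset).measure_zero volume)
    intro t ht
    exact hroots (by simpa using ht)
  have hmeas : MeasurableSet {p : Matrix (Fin n) (Fin q) ℝ × ℝ | (ιᵀ * (p.1 + p.2 • ι)).det ≠ 0} :=
    (measurableSet_singleton (0 : ℝ)).compl.preimage hcont.measurable
  obtain ⟨t, ht⟩ := ((Measure.ae_ae_comm hmeas).mp hline).exists
  have hx : ∀ᵐ x : Matrix (Fin n) (Fin q) ℝ, (ιᵀ * x).det ≠ 0 := by
    have h := (measurePreserving_add_right (volume : Measure (Matrix (Fin n) (Fin q) ℝ))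
      (-(t • ι))).quasiMeasurePreserving.ae ht
    filter_upwards [h] with x hx
    simpa using hx
  filter_upwards [hx] with x hx
  rw [← posDef_gram_iff]
  have hinj : Function.Injective x.mulVec := by
    have h1 : Function.Injective (ιᵀ * x).mulVec :=
      Matrix.mulVec_injective_iff_isUnit.mpr
        ((Matrix.isUnit_iff_isUnit_det _).mpr (isUnit_iff_ne_zero.mpr hx))
    intro v w hvw
    apply h1
    rw [← Matrix.mulVec_mulVec, ← Matrix.mulVec_mulVec, hvw]
  simpa using Matrix.PosDef.conjTranspose_mul_self x hinj

/-! ### The invariant measure on matrices of full rank -/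

/-- The measure `|x|_q ^ (-n) dx` on `n × q` matrices. It is invariant under all
substitutions `x ↦ g x A` with `g ∈ O(n)` and `A ∈ GL_q`; for `n = q` it is the Haar measure of
`GL_q`. Matrices of deficient rank, where the density takes the value `0⁻¹ = 0`, form a null
set. -/
def invariantVolume (n q : ℕ) : Measure (Matrix (Fin n) (Fin q) ℝ) :=
  volume.withDensity fun x => ENNReal.ofReal (gramVolume x ^ n)⁻¹

theorem measurable_density {n q m : ℕ} :
    Measurable fun x : Matrix (Fin n) (Fin q) ℝ => ENNReal.ofReal (gramVolume x ^ m)⁻¹ :=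
  ((measurable_gramVolume.pow_const m).inv).ennreal_ofReal

instance {n q : ℕ} : SigmaFinite (invariantVolume n q) :=
  SigmaFinite.withDensity_ofReal _

theorem lintegral_withDensity_apply {X : Type*} [MeasurableSpace X] (μ : Measure X)
    {d f : X → ℝ≥0∞} (hd : Measurable d) (hf : Measurable f) :
    ∫⁻ x, f x ∂μ.withDensity d = ∫⁻ x, d x * f x ∂μ :=
  lintegral_withDensity_eq_lintegral_mul _ hd hf

/-- If `T_* μ = b μ` and `d ∘ T = b d`, with `a` the inverse of `b`, then `T` preserves the measure
`d μ`. -/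
theorem map_withDensity_eq_self {X : Type*} [MeasurableSpace X] {μ : Measure X} {T : X → X}
    (hT : Measurable T) {d : X → ℝ≥0∞} (hd : Measurable d) {a b : ℝ≥0∞} (hab : a * b = 1)
    (hμ : μ.map T = b • μ) (hdT : ∀ x, d x = a * d (T x)) :
    (μ.withDensity d).map T = μ.withDensity d := by
  refine Measure.ext_of_lintegral _ fun f hf => ?_
  rw [lintegral_map hf hT, lintegral_withDensity_apply (f := fun x => f (T x)) _ hd (hf.comp hT),
    lintegral_withDensity_apply _ hd hf]
  calc ∫⁻ x, d x * f (T x) ∂μ = ∫⁻ x, a * (d (T x) * f (T x)) ∂μ := by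
        refine lintegral_congr fun x => ?_
        rw [hdT x, mul_assoc]
    _ = a * ∫⁻ x, d x * f x ∂(μ.map T) := by
        rw [lintegral_map (f := fun x => d x * f x) (hd.mul hf) hT,
          lintegral_const_mul a (f := fun x => d (T x) * f (T x)) ((hd.mul hf).comp hT)]
    _ = ∫⁻ x, d x * f x ∂μ := by
        rw [hμ, lintegral_smul_measure, smul_eq_mul, ← mul_assoc, hab, one_mul]

theorem ofReal_pow_mul_ofReal_inv_pow {d : ℝ} (hd : d ≠ 0) (n : ℕ) :
    ENNReal.ofReal (|d| ^ n) * ENNReal.ofReal |d⁻¹| ^ n = 1 := by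
  rw [← ENNReal.ofReal_pow (abs_nonneg _), ← ENNReal.ofReal_mul (by positivity), ← mul_pow,
    abs_inv, mul_inv_cancel₀ (abs_ne_zero.mpr hd), one_pow, ENNReal.ofReal_one]

theorem map_invariantVolume {n q : ℕ} (g : O n) {A : Matrix (Fin q) (Fin q) ℝ} (hA : A.det ≠ 0) :
    (invariantVolume n q).map (fun x => g.1 * x * A) = invariantVolume n q := by
  have hdet : |g.1.det| = 1 := by
    have h := congrArg Matrix.det (orthogonal_transpose_mul g)
    rw [Matrix.det_mul, Matrix.det_transpose, Matrix.det_one] at h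
    rw [← abs_mul_abs_self] at h
    nlinarith [abs_nonneg g.1.det]
  have hR : Measurable fun x : Matrix (Fin n) (Fin q) ℝ => x * A :=
    (continuous_id.matrix_mul continuous_const).measurable
  have hL : Measurable fun x : Matrix (Fin n) (Fin q) ℝ => g.1 * x :=
    (continuous_const.matrix_mul continuous_id).measurable
  refine map_withDensity_eq_self (hR.comp hL) measurable_density
    (ofReal_pow_mul_ofReal_inv_pow hA n) ?_ fun x => ?_
  · change volume.map ((fun x : Matrix (Fin n) (Fin q) ℝ => x * A) ∘ fun x => g.1 * x) = _
    rw [← Measure.map_map hR hL, map_mul_left_volume (abs_pos.mp (by rw [hdet]; exact one_pos)),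
      abs_inv, hdet, inv_one, ENNReal.ofReal_one, one_pow, one_smul, map_mul_right_volume hA,
      Fintype.card_fin]
  · rw [Function.comp_apply, gramVolume_orthogonal_mul, ← ENNReal.ofReal_mul (by positivity),
      mul_pow, mul_inv, ← mul_assoc, mul_inv_cancel₀ (pow_ne_zero _ (abs_ne_zero.mpr hA)), one_mul]

theorem map_mul_right_invariantVolume {n q : ℕ} {A : Matrix (Fin q) (Fin q) ℝ} (hA : A.det ≠ 0) :
    (invariantVolume n q).map (fun x => x * A) = invariantVolume n q := by
  simpa using map_invariantVolume (n := n) 1 hA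

theorem map_mul_left_invariantVolume {q : ℕ} {B : Matrix (Fin q) (Fin q) ℝ} (hB : B.det ≠ 0) :
    (invariantVolume q q).map (fun x => B * x) = invariantVolume q q := by
  have hL : Measurable fun x : Matrix (Fin q) (Fin q) ℝ => B * x :=
    (continuous_const.matrix_mul continuous_id).measurable
  refine map_withDensity_eq_self hL measurable_density
    (ofReal_pow_mul_ofReal_inv_pow hB q) ?_ fun x => ?_
  · simpa using map_mul_left_volume (ι := Fin q) hB
  · rw [gramVolume_square, gramVolume_square, Matrix.det_mul, abs_mul,
      ← ENNReal.ofReal_mul (by positivity), mul_pow, mul_inv, ← mul_assoc,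
      mul_inv_cancel₀ (pow_ne_zero _ (abs_ne_zero.mpr hB)), one_mul]

theorem ae_invariantVolume_gramVolume_pos {n q : ℕ} (hq : q ≤ n) :
    ∀ᵐ x ∂invariantVolume n q, 0 < gramVolume x :=
  (withDensity_absolutelyContinuous _ _).ae_le (ae_gramVolume_pos hq)

theorem lintegral_mul_invariantVolume {n q : ℕ} (hq : q ≤ n)
    {f : Matrix (Fin n) (Fin q) ℝ → ℝ≥0∞} (hf : Measurable f) :
    ∫⁻ x, f x * ENNReal.ofReal (gramVolume x ^ n) ∂invariantVolume n q = ∫⁻ x, f x := by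
  rw [invariantVolume, lintegral_withDensity_apply
    (f := fun x => f x * ENNReal.ofReal (gramVolume x ^ n)) _ measurable_density
    (hf.mul (measurable_gramVolume.pow_const n).ennreal_ofReal)]
  refine lintegral_congr_ae ?_
  filter_upwards [ae_gramVolume_pos hq] with x hx
  rw [mul_left_comm, ← ENNReal.ofReal_mul (by positivity),
    inv_mul_cancel₀ (by positivity), ENNReal.ofReal_one, mul_one]

/-! ### Uniqueness of invariant measures -/

/-- A measure `m` invariant under a transitive family of substitutions `act a` is a multiple of the
orbit measure `(a ↦ act a x₀)_* γ`. The measure `γ` on the parameters is required to be unimodular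
in the sense that the orbit measures of `act` and of the inverse substitutions `act'` do not depend
on the base point. As for Haar measures, one compares both sides of
`∫ h dm * ∫ f (act a x₀) dγ(a) = ∫ f dm * ∫ h (act' a x₀) dγ(a)`. -/
theorem exists_eq_smul_map_of_transitive {Γ X : Type*} [MeasurableSpace Γ] [MeasurableSpace X]
    {γ : Measure Γ} [SFinite γ] {m : Measure X} [SigmaFinite m] (hm : m ≠ 0) {act act' : Γ → X → X}
    (hact : Measurable (Function.uncurry act)) (hact' : Measurable (Function.uncurry act')) (x₀ : X)
    (horbit : ∀ᵐ x ∂m, γ.map (fun a => act a x) = γ.map fun a => act a x₀)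
    (horbit' : ∀ᵐ x ∂m, γ.map (fun a => act' a x) = γ.map fun a => act' a x₀)
    (hinv : ∀ᵐ a ∂γ, m.map (act a) = m) (hleft : ∀ᵐ a ∂γ, ∀ x, act' a (act a x) = x)
    {f₀ : X → ℝ≥0∞} (hf₀ : Measurable f₀) (hpos : ∀ᵐ x ∂m, f₀ x ≠ 0)
    (hne : ∫⁻ a, f₀ (act a x₀) ∂γ ≠ 0) (hfin : ∫⁻ a, f₀ (act a x₀) ∂γ ≠ ∞) :
    ∃ c : ℝ≥0∞, c ≠ 0 ∧ c ≠ ∞ ∧ m = c • γ.map fun a => act a x₀ := by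
  have hax : ∀ x, Measurable fun a => act a x := fun x => hact.comp measurable_prodMk_right
  have hax' : ∀ x, Measurable fun a => act' a x := fun x => hact'.comp measurable_prodMk_right
  have hacta : ∀ a, Measurable (act a) := fun a => hact.comp measurable_prodMk_left
  have key : ∀ f h : X → ℝ≥0∞, Measurable f → Measurable h →
      (∫⁻ x, h x ∂m) * ∫⁻ a, f (act a x₀) ∂γ = (∫⁻ x, f x ∂m) * ∫⁻ a, h (act' a x₀) ∂γ := by
    intro f h hf hh
    calc (∫⁻ x, h x ∂m) * ∫⁻ a, f (act a x₀) ∂γ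
        = ∫⁻ x, h x * ∫⁻ a, f (act a x) ∂γ ∂m := by
          rw [← lintegral_mul_const _ hh]
          refine lintegral_congr_ae ?_
          filter_upwards [horbit] with x hx
          rw [← lintegral_map hf (hax x), hx, lintegral_map hf (hax x₀)]
      _ = ∫⁻ x, ∫⁻ a, h x * f (act a x) ∂γ ∂m :=
          lintegral_congr fun x => (lintegral_const_mul _ (hf.comp (hax x))).symm
      _ = ∫⁻ a, ∫⁻ x, h x * f (act a x) ∂m ∂γ :=
          lintegral_lintegral_swap ((hh.comp measurable_fst).mul
            (hf.comp (hact.comp measurable_swap))).aemeasurable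
      _ = ∫⁻ a, ∫⁻ x, h (act' a x) * f x ∂m ∂γ := by
          refine lintegral_congr_ae ?_
          filter_upwards [hinv, hleft] with a ha ha'
          have hm' : Measurable fun x => h (act' a x) * f x :=
            (hh.comp (hact'.comp measurable_prodMk_left)).mul hf
          conv_rhs => rw [← ha]
          rw [lintegral_map hm' (hacta a)]
          simp only [ha']
      _ = ∫⁻ x, ∫⁻ a, h (act' a x) * f x ∂γ ∂m :=
          (lintegral_lintegral_swap ((hh.comp (hact'.comp measurable_swap)).mul
            (hf.comp measurable_fst)).aemeasurable).symm
      _ = ∫⁻ x, f x * ∫⁻ a, h (act' a x) ∂γ ∂m := by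
          refine lintegral_congr fun x => ?_
          rw [lintegral_mul_const (f := fun a => h (act' a x)) _ (hh.comp (hax' x)), mul_comm]
      _ = _ := by
          rw [← lintegral_mul_const _ hf]
          refine lintegral_congr_ae ?_
          filter_upwards [horbit'] with x hx
          rw [← lintegral_map hh (hax' x), hx, lintegral_map hh (hax' x₀)]
  -- the identity for `h = 1_s` with `0 < m s < ∞` determines `m`, and for `f = f₀` it shows that
  -- the orbit integral of `h` is neither `0` nor `∞`
  obtain ⟨s, hs, -, hs0, hsfin⟩ := Measure.exists_subset_measure_lt_top (μ := m) (r := 0)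
    MeasurableSet.univ (pos_iff_ne_zero.mpr (Measure.measure_univ_ne_zero.mpr hm))
  let h : X → ℝ≥0∞ := s.indicator 1
  have hh : Measurable h := measurable_one.indicator hs
  have hhm : ∫⁻ x, h x ∂m = m s := lintegral_indicator_one hs
  have h₀ := key f₀ h hf₀ hh
  rw [hhm] at h₀
  have hm₀ : ∫⁻ x, f₀ x ∂m ≠ 0 := by
    rw [Ne, lintegral_eq_zero_iff hf₀]
    intro hz
    refine hm (ae_eq_bot.mp (Filter.eventually_false_iff_eq_bot.mp ?_))
    filter_upwards [hz, hpos] with x hx hx'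
    exact hx' hx
  have hprod0 : m s * ∫⁻ a, f₀ (act a x₀) ∂γ ≠ 0 := mul_ne_zero hs0.ne' hne
  have hprod : m s * ∫⁻ a, f₀ (act a x₀) ∂γ ≠ ∞ := ENNReal.mul_ne_top hsfin.ne hfin
  have hI0 : ∫⁻ a, h (act' a x₀) ∂γ ≠ 0 := by
    intro hz
    rw [hz, mul_zero] at h₀
    exact hprod0 h₀
  have hI : ∫⁻ a, h (act' a x₀) ∂γ ≠ ∞ := by
    intro hz
    rw [hz, ENNReal.mul_top hm₀] at h₀
    exact hprod h₀
  refine ⟨m s / ∫⁻ a, h (act' a x₀) ∂γ, (ENNReal.div_pos hs0.ne' hI).ne',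
    ENNReal.div_ne_top hsfin.ne hI0, Measure.ext_of_lintegral _ fun f hf => ?_⟩
  have hf' := key f h hf hh
  rw [hhm] at hf'
  rw [lintegral_smul_measure, lintegral_map hf (hax x₀), smul_eq_mul,
    ENNReal.mul_div_right_comm.symm, hf', ENNReal.mul_div_cancel_right hI0 hI]

/-! ### Gaussian integrals -/

/-- The Gaussian `exp (- tr (xᵀ x))`. -/
def gaussian {n q : ℕ} (x : Matrix (Fin n) (Fin q) ℝ) : ℝ≥0∞ :=
  ENNReal.ofReal (Real.exp (-(xᵀ * x).trace))

theorem gaussian_congr {n m q : ℕ} {x : Matrix (Fin n) (Fin q) ℝ} {y : Matrix (Fin m) (Fin q) ℝ}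
    (h : xᵀ * x = yᵀ * y) : gaussian x = gaussian y := by
  rw [gaussian, gaussian, h]

theorem measurable_gaussian {n q : ℕ} :
    Measurable (gaussian : Matrix (Fin n) (Fin q) ℝ → ℝ≥0∞) :=
  (Real.continuous_exp.comp (continuous_id.matrix_transpose.matrix_mul
    continuous_id).matrix_trace.neg).measurable.ennreal_ofReal

theorem gaussian_ne_zero {n q : ℕ} (x : Matrix (Fin n) (Fin q) ℝ) : gaussian x ≠ 0 :=
  (ENNReal.ofReal_pos.mpr (Real.exp_pos _)).ne'

theorem lintegral_gaussian (n q : ℕ) :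
    ∫⁻ x : Matrix (Fin n) (Fin q) ℝ, gaussian x =
      ENNReal.ofReal (Real.pi ^ ((n : ℝ) * (q : ℝ) / 2)) := by
  have hprod : ∀ x : Matrix (Fin n) (Fin q) ℝ,
      Real.exp (-(xᵀ * x).trace) = ∏ i, ∏ j, Real.exp (-1 * x i j ^ 2) := by
    intro x
    simp only [← Real.exp_sum]
    congr 1
    rw [Matrix.trace, Finset.sum_comm, ← Finset.sum_neg_distrib]
    refine Finset.sum_congr rfl fun j _ => ?_
    simp [Matrix.mul_apply, pow_two]
  have hone : ∫ t : ℝ, Real.exp (-1 * t ^ 2) = Real.sqrt Real.pi := by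
    simpa using integral_gaussian 1
  have hint : Integrable fun t : ℝ => Real.exp (-1 * t ^ 2) := integrable_exp_neg_mul_sq one_pos
  have hint2 : Integrable fun x : Fin n → Fin q → ℝ => ∏ i, ∏ j, Real.exp (-1 * x i j ^ 2) :=
    Integrable.fintype_prod (f := fun _ (v : Fin q → ℝ) => ∏ j, Real.exp (-1 * v j ^ 2))
      fun _ => Integrable.fintype_prod (f := fun _ t => Real.exp (-1 * t ^ 2)) fun _ => hint
  have hval : ∫ x : Fin n → Fin q → ℝ, ∏ i, ∏ j, Real.exp (-1 * x i j ^ 2) =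
      Real.pi ^ ((n : ℝ) * (q : ℝ) / 2) := by
    rw [integral_fintype_prod_volume_eq_pow fun v : Fin q → ℝ => ∏ j, Real.exp (-1 * v j ^ 2),
      integral_fintype_prod_volume_eq_pow fun t : ℝ => Real.exp (-1 * t ^ 2), hone,
      Fintype.card_fin, Fintype.card_fin, ← pow_mul, Real.sqrt_eq_rpow, ← Real.rpow_natCast,
      ← Real.rpow_mul Real.pi_pos.le]
    congr 1
    push_cast
    ring
  rw [← hval, ofReal_integral_eq_lintegral_ofReal hint2
    (Filter.Eventually.of_forall fun x => by positivity)]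
  refine lintegral_congr fun x => ?_
  rw [gaussian, hprod]

/-! ### Polar integration -/

/-- The Haar probability measure on `O(n)`. -/
abbrev haarO (n : ℕ) : Measure (O n) :=
  Measure.haarMeasure (⊤ : TopologicalSpace.PositiveCompacts (O n))

instance (n : ℕ) : IsProbabilityMeasure (haarO n) := ⟨Measure.haarMeasure_self (K₀ := ⊤)⟩

instance (n : ℕ) : (haarO n).IsMulRightInvariant where
  map_mul_right_eq_self g := by
    have hm : Measurable fun h : O n => h * g := (continuous_mul_const g).measurable
    have : IsProbabilityMeasure ((haarO n).map fun h => h * g) :=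
      Measure.isProbabilityMeasure_map hm.aemeasurable
    exact Measure.isHaarMeasure_eq_of_isProbabilityMeasure _ _

theorem measurable_matrix_inv {q : ℕ} :
    Measurable fun A : Matrix (Fin q) (Fin q) ℝ => A⁻¹ := by
  have hs : Continuous fun p : ℝ × Matrix (Fin q) (Fin q) ℝ => p.1 • p.2 := by fun_prop
  have hdet : Measurable fun A : Matrix (Fin q) (Fin q) ℝ => A.det⁻¹ :=
    (continuous_id.matrix_det).measurable.inv
  have hadj : Measurable fun A : Matrix (Fin q) (Fin q) ℝ => A.adjugate :=
    (continuous_id.matrix_adjugate).measurable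
  have h : (fun A : Matrix (Fin q) (Fin q) ℝ => A⁻¹) = fun A => A.det⁻¹ • A.adjugate := by
    funext A
    simp [Matrix.inv_def]
  rw [h]
  exact hs.measurable.comp (hdet.prodMk hadj)

theorem ae_det_ne_zero {q : ℕ} : ∀ᵐ A ∂invariantVolume q q, A.det ≠ 0 := by
  filter_upwards [ae_invariantVolume_gramVolume_pos le_rfl] with A hA
  rw [gramVolume_square] at hA
  exact abs_pos.mp hA

theorem invariantVolume_ne_zero {n q : ℕ} (hq : q ≤ n) : invariantVolume n q ≠ 0 := by
  intro h
  have := lintegral_mul_invariantVolume hq (measurable_gaussian (n := n) (q := q))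
  rw [h, lintegral_zero_measure, lintegral_gaussian] at this
  exact (ENNReal.ofReal_pos.mpr (Real.rpow_pos_of_pos Real.pi_pos _)).ne this

/-- The integral `∫ exp (- tr (Aᵀ A)) |det A| ^ n dA / |det A| ^ q` over `q × q` matrices. -/
def gaussianMoment (q n : ℕ) : ℝ≥0∞ :=
  ∫⁻ A, gaussian A * ENNReal.ofReal (gramVolume A ^ n) ∂invariantVolume q q

theorem gaussianMoment_self (q : ℕ) :
    gaussianMoment q q = ENNReal.ofReal (Real.pi ^ ((q : ℝ) * (q : ℝ) / 2)) := by
  rw [gaussianMoment, lintegral_mul_invariantVolume le_rfl measurable_gaussian, lintegral_gaussian]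

theorem measurable_gaussian_mul {n q m : ℕ} :
    Measurable fun x : Matrix (Fin n) (Fin q) ℝ =>
      gaussian x * ENNReal.ofReal (gramVolume x ^ m) :=
  measurable_gaussian.mul (measurable_gramVolume.pow_const m).ennreal_ofReal

theorem gram_polar {n q : ℕ} (hq : q ≤ n) (g : O n) (A : Matrix (Fin q) (Fin q) ℝ) :
    (g.1 * standardFrame hq * A)ᵀ * (g.1 * standardFrame hq * A) = Aᵀ * A := by
  rw [gram_orthogonal_mul, transpose_standardFrame_mul_self, Matrix.mul_one]

theorem measurable_polar {n q : ℕ} (hq : q ≤ n) :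
    Measurable fun p : O n × Matrix (Fin q) (Fin q) ℝ => p.1.1 * standardFrame hq * p.2 :=
  (((continuous_subtype_val.comp continuous_fst).matrix_mul continuous_const).matrix_mul
    continuous_snd).measurable

theorem lintegral_polar_gaussian_mul {n q : ℕ} (hq : q ≤ n) (m : ℕ) :
    ∫⁻ p : O n × Matrix (Fin q) (Fin q) ℝ, gaussian (p.1.1 * standardFrame hq * p.2) *
      ENNReal.ofReal (gramVolume (p.1.1 * standardFrame hq * p.2) ^ m)
      ∂(haarO n).prod (invariantVolume q q) = gaussianMoment q m := by
  have h : ∀ p : O n × Matrix (Fin q) (Fin q) ℝ, gaussian (p.1.1 * standardFrame hq * p.2) *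
      ENNReal.ofReal (gramVolume (p.1.1 * standardFrame hq * p.2) ^ m) =
      gaussian p.2 * ENNReal.ofReal (gramVolume p.2 ^ m) := fun p => by
    rw [gaussian_congr (gram_polar hq p.1 p.2), gramVolume_congr (gram_polar hq p.1 p.2)]
  simp only [h]
  have hm : Measurable fun p : O n × Matrix (Fin q) (Fin q) ℝ =>
      gaussian p.2 * ENNReal.ofReal (gramVolume p.2 ^ m) :=
    measurable_gaussian_mul.comp measurable_snd
  rw [lintegral_prod _ hm.aemeasurable]
  simp [gaussianMoment]

theorem measurable_orthogonal_mul_mul {n m q : ℕ} :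
    Measurable fun p : (O n × Matrix (Fin m) (Fin q) ℝ) × Matrix (Fin n) (Fin m) ℝ =>
      p.1.1.1 * p.2 * p.1.2 :=
  (((continuous_subtype_val.comp (continuous_fst.comp continuous_fst)).matrix_mul
    continuous_snd).matrix_mul (continuous_snd.comp continuous_fst)).measurable

theorem measurable_orthogonal_mul_mul_inv {n q : ℕ} :
    Measurable fun p : (O n × Matrix (Fin q) (Fin q) ℝ) × Matrix (Fin n) (Fin q) ℝ =>
      (p.1.1⁻¹).1 * p.2 * p.1.2⁻¹ := by
  have hinv : Measurable fun p : (O n × Matrix (Fin q) (Fin q) ℝ) × Matrix (Fin n) (Fin q) ℝ =>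
      p.1.1⁻¹ := (measurable_fst.comp measurable_fst).inv
  have hinv' : Measurable fun p : (O n × Matrix (Fin q) (Fin q) ℝ) × Matrix (Fin n) (Fin q) ℝ =>
      p.1.2⁻¹ := measurable_matrix_inv.comp (measurable_snd.comp measurable_fst)
  have h := (measurable_orthogonal_mul_mul (n := n) (m := q) (q := q)).comp
    ((hinv.prodMk hinv').prodMk measurable_snd)
  exact h

/-- The orbit measure does not depend on the base point, because the Haar measure of
`O(n) × GL_q` is invariant on both sides. -/
theorem map_orbit_eq {n q : ℕ} (hq : q ≤ n) {x : Matrix (Fin n) (Fin q) ℝ}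
    (hx : 0 < gramVolume x) :
    ((haarO n).prod (invariantVolume q q)).map (fun p => p.1.1 * x * p.2) =
      ((haarO n).prod (invariantVolume q q)).map fun p => p.1.1 * standardFrame hq * p.2 := by
  obtain ⟨g, B, hB, rfl⟩ := exists_polar hq hx
  have hmp : MeasurePreserving (Prod.map (fun h : O n => h * g) fun A => B * A)
      ((haarO n).prod (invariantVolume q q)) ((haarO n).prod (invariantVolume q q)) :=
    (measurePreserving_mul_right (haarO n) g).prod
      ⟨(continuous_const.matrix_mul continuous_id).measurable, map_mul_left_invariantVolume hB⟩
  conv_rhs => rw [← hmp.map_eq]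
  rw [Measure.map_map (measurable_polar hq) hmp.measurable]
  congr 1
  funext p
  simp only [Function.comp_apply, Prod.map, Submonoid.coe_mul, Matrix.mul_assoc]

theorem map_inv_orbit_eq {n q : ℕ} (hq : q ≤ n) {x : Matrix (Fin n) (Fin q) ℝ}
    (hx : 0 < gramVolume x) :
    ((haarO n).prod (invariantVolume q q)).map (fun p => (p.1⁻¹).1 * x * p.2⁻¹) =
      ((haarO n).prod (invariantVolume q q)).map
        fun p => (p.1⁻¹).1 * standardFrame hq * p.2⁻¹ := by
  obtain ⟨g, B, hB, rfl⟩ := exists_polar hq hx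
  have hB' : B⁻¹.det ≠ 0 := by
    rw [Matrix.det_nonsing_inv, Ring.inverse_eq_inv']
    exact inv_ne_zero hB
  have hmp : MeasurePreserving (Prod.map (fun h : O n => g⁻¹ * h) fun A => A * B⁻¹)
      ((haarO n).prod (invariantVolume q q)) ((haarO n).prod (invariantVolume q q)) :=
    (measurePreserving_mul_left (haarO n) g⁻¹).prod
      ⟨(continuous_id.matrix_mul continuous_const).measurable, map_mul_right_invariantVolume hB'⟩
  have hm := (measurable_orthogonal_mul_mul_inv (n := n) (q := q)).comp
    (measurable_prodMk_right (y := standardFrame hq))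
  conv_rhs => rw [← hmp.map_eq]
  refine Eq.trans ?_ (Measure.map_map hm hmp.measurable).symm
  congr 1
  funext p
  simp only [Function.comp_apply, Prod.map, mul_inv_rev, inv_inv, Matrix.mul_inv_rev,
    Matrix.nonsing_inv_nonsing_inv _ (isUnit_iff_ne_zero.mpr hB), Submonoid.coe_mul,
    Matrix.mul_assoc]

/-- Integration in polar coordinates `x = g (I_q; 0) A` with `g ∈ O(n)` and `A ∈ GL_q`. -/
theorem exists_invariantVolume_eq_polar {n q : ℕ} (hq : q ≤ n) :
    ∃ c : ℝ≥0∞, c ≠ 0 ∧ c ≠ ∞ ∧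
      c * gaussianMoment q n = ENNReal.ofReal (Real.pi ^ ((n : ℝ) * (q : ℝ) / 2)) ∧
      invariantVolume n q = c • ((haarO n).prod (invariantVolume q q)).map
        fun p => p.1.1 * standardFrame hq * p.2 := by
  have hae : ∀ᵐ a ∂(haarO n).prod (invariantVolume q q), a.2.det ≠ 0 :=
    Measure.quasiMeasurePreserving_snd.ae ae_det_ne_zero
  -- the test function `exp (- tr (xᵀ x)) |x|_q ^ q` has finite orbit integral, since the factor
  -- `|A| ^ q` turns the Haar measure of `GL_q` into Lebesgue measure
  have hπ : ∫⁻ p : O n × Matrix (Fin q) (Fin q) ℝ, gaussian (p.1.1 * standardFrame hq * p.2) *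
      ENNReal.ofReal (gramVolume (p.1.1 * standardFrame hq * p.2) ^ q)
      ∂(haarO n).prod (invariantVolume q q) =
      ENNReal.ofReal (Real.pi ^ ((q : ℝ) * (q : ℝ) / 2)) := by
    rw [lintegral_polar_gaussian_mul, gaussianMoment_self]
  obtain ⟨c, hc0, hc, h⟩ := exists_eq_smul_map_of_transitive
    (γ := (haarO n).prod (invariantVolume q q)) (act := fun p x => p.1.1 * x * p.2)
    (act' := fun p x => (p.1⁻¹).1 * x * p.2⁻¹)
    (f₀ := fun x => gaussian x * ENNReal.ofReal (gramVolume x ^ q))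
    (invariantVolume_ne_zero hq) measurable_orthogonal_mul_mul measurable_orthogonal_mul_mul_inv
    (standardFrame hq)
    ((ae_invariantVolume_gramVolume_pos hq).mono fun x hx => map_orbit_eq hq hx)
    ((ae_invariantVolume_gramVolume_pos hq).mono fun x hx => map_inv_orbit_eq hq hx)
    (hae.mono fun a ha => map_invariantVolume a.1 ha)
    (hae.mono fun a ha x => by
      have hu : IsUnit a.2.det := isUnit_iff_ne_zero.mpr ha
      calc (a.1⁻¹).1 * (a.1.1 * x * a.2) * a.2⁻¹
          = ((a.1⁻¹).1 * a.1.1) * x * (a.2 * a.2⁻¹) := by simp only [Matrix.mul_assoc]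
        _ = x := by rw [orthogonal_inv_mul, Matrix.mul_nonsing_inv _ hu, Matrix.one_mul,
            Matrix.mul_one])
    measurable_gaussian_mul
    ((ae_invariantVolume_gramVolume_pos hq).mono fun x hx =>
      mul_ne_zero (gaussian_ne_zero x) (ENNReal.ofReal_pos.mpr (pow_pos hx q)).ne')
    (hπ.trans_ne (ENNReal.ofReal_pos.mpr (Real.rpow_pos_of_pos Real.pi_pos _)).ne')
    (hπ.trans_ne ENNReal.ofReal_ne_top)
  refine ⟨c, hc0, hc, ?_, h⟩
  have hG := lintegral_mul_invariantVolume hq (measurable_gaussian (n := n) (q := q))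
  rw [h, lintegral_gaussian, lintegral_smul_measure,
    lintegral_map measurable_gaussian_mul (measurable_polar hq)] at hG
  rw [← hG, smul_eq_mul, lintegral_polar_gaussian_mul hq n]

/-- The integral over `n × q` matrices as an integral over `q`-tuples in a rotated `ℝᵏ × 0`. It
follows from polar integration in `n × q` and in `k × q` matrices, as a rotation of `ℝᵏ` extends to
one of `ℝⁿ`. -/
theorem exists_lintegral_rotated_frame {n k q : ℕ} (hq : q ≤ k) (hk : k ≤ n) :
    ∃ C : ℝ≥0∞, C ≠ 0 ∧ C ≠ ∞ ∧
      C * (ENNReal.ofReal (Real.pi ^ ((k : ℝ) * (q : ℝ) / 2)) * gaussianMoment q n) =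
        ENNReal.ofReal (Real.pi ^ ((n : ℝ) * (q : ℝ) / 2)) * gaussianMoment q k ∧
      ∀ f : Matrix (Fin n) (Fin q) ℝ → ℝ≥0∞, Measurable f →
        ∫⁻ x, f x = C * ∫⁻ g, (∫⁻ y : Matrix (Fin k) (Fin q) ℝ, f (g.1 * standardFrame hk * y) *
          ENNReal.ofReal (gramVolume y ^ (n - k))) ∂haarO n := by
  obtain ⟨cn, hn0, hn, hnπ, hnm⟩ := exists_invariantVolume_eq_polar (hq.trans hk)
  obtain ⟨ck, hk0, hk', hkπ, hkm⟩ := exists_invariantVolume_eq_polar hq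
  refine ⟨cn / ck, (ENNReal.div_pos hn0 hk').ne', ENNReal.div_ne_top hn hk0, ?_, fun f hf => ?_⟩
  · rw [← hkπ, ← hnπ]
    calc cn / ck * (ck * gaussianMoment q k * gaussianMoment q n)
        = (cn / ck * ck) * (gaussianMoment q k * gaussianMoment q n) := by ring
      _ = cn * gaussianMoment q n * gaussianMoment q k := by
        rw [ENNReal.div_mul_cancel hk0 hk']
        ring
  have hw : ∀ (m p : ℕ), Measurable fun x : Matrix (Fin m) (Fin q) ℝ =>
      ENNReal.ofReal (gramVolume x ^ p) :=
    fun m p => (measurable_gramVolume.pow_const p).ennreal_ofReal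
  have hF : Measurable fun x : Matrix (Fin n) (Fin q) ℝ =>
      f x * ENNReal.ofReal (gramVolume x ^ n) := hf.mul (hw n n)
  have hact : Measurable fun p : O n × Matrix (Fin k) (Fin q) ℝ =>
      p.1.1 * standardFrame hk * p.2 :=
    (((continuous_subtype_val.comp continuous_fst).matrix_mul continuous_const).matrix_mul
      continuous_snd).measurable
  -- `J` is the integral of `f(x) |x|^n` in polar coordinates
  set J := ∫⁻ A, ∫⁻ g : O n, f (g.1 * standardFrame (hq.trans hk) * A) *
    ENNReal.ofReal (gramVolume A ^ n) ∂haarO n ∂invariantVolume q q with hJ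
  have hleft : ∫⁻ x, f x = cn * J := by
    rw [← lintegral_mul_invariantVolume (hq.trans hk) hf, hnm, lintegral_smul_measure,
      lintegral_map hF (measurable_polar _), smul_eq_mul]
    simp only [gramVolume_congr (gram_polar _ _ _)]
    have hm : Measurable fun p : O n × Matrix (Fin q) (Fin q) ℝ =>
        f (p.1.1 * standardFrame (hq.trans hk) * p.2) * ENNReal.ofReal (gramVolume p.2 ^ n) :=
      (hf.comp (measurable_polar _)).mul ((hw q n).comp measurable_snd)
    rw [lintegral_prod_symm _ hm.aemeasurable]
  have hright : ∫⁻ g, (∫⁻ y : Matrix (Fin k) (Fin q) ℝ, f (g.1 * standardFrame hk * y) *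
      ENNReal.ofReal (gramVolume y ^ (n - k))) ∂haarO n = ck * J := by
    -- with `(I_k; 0) h = h' (I_k; 0)`, the rotation `h'` is absorbed by the Haar measure of `O(n)`
    have hinner : ∀ h : O k, ∀ A : Matrix (Fin q) (Fin q) ℝ,
        ∫⁻ g : O n, f (g.1 * standardFrame hk * (h.1 * standardFrame hq * A)) *
          ENNReal.ofReal (gramVolume A ^ n) ∂haarO n =
        ∫⁻ g : O n, f (g.1 * standardFrame (hq.trans hk) * A) *
          ENNReal.ofReal (gramVolume A ^ n) ∂haarO n := by
      intro h A
      obtain ⟨h', hh'⟩ := exists_orthogonal_mul_standardFrame hk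
        (z := standardFrame hk * h.1) (by
          rw [gram_standardFrame_mul]
          exact orthogonal_transpose_mul h)
      rw [← lintegral_mul_right_eq_self (μ := haarO n)
        (fun g : O n => f (g.1 * standardFrame (hq.trans hk) * A) *
          ENNReal.ofReal (gramVolume A ^ n)) h']
      refine lintegral_congr fun g => ?_
      congr 2
      calc g.1 * standardFrame hk * (h.1 * standardFrame hq * A)
          = g.1 * (standardFrame hk * h.1) * standardFrame hq * A := by
            simp only [Matrix.mul_assoc]
        _ = _ := by
            rw [← hh', ← standardFrame_mul_standardFrame hk hq, Submonoid.coe_mul]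
            simp only [Matrix.mul_assoc]
    have hG : Measurable fun p : O n × Matrix (Fin k) (Fin q) ℝ =>
        f (p.1.1 * standardFrame hk * p.2) * ENNReal.ofReal (gramVolume p.2 ^ n) :=
      (hf.comp hact).mul ((hw k n).comp measurable_snd)
    calc ∫⁻ g, (∫⁻ y : Matrix (Fin k) (Fin q) ℝ, f (g.1 * standardFrame hk * y) *
          ENNReal.ofReal (gramVolume y ^ (n - k))) ∂haarO n
        = ∫⁻ g, ∫⁻ y, f (g.1 * standardFrame hk * y) *
          ENNReal.ofReal (gramVolume y ^ n) ∂invariantVolume k q ∂haarO n := by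
          refine lintegral_congr fun g => ?_
          rw [← lintegral_mul_invariantVolume hq
            (f := fun y => f (g.1 * standardFrame hk * y) * ENNReal.ofReal (gramVolume y ^ (n - k)))
            ((hf.comp (hact.comp measurable_prodMk_left)).mul (hw k _))]
          refine lintegral_congr fun y => ?_
          rw [mul_assoc, ← ENNReal.ofReal_mul (pow_nonneg (gramVolume_nonneg _) _), ← pow_add,
            Nat.sub_add_cancel hk]
      _ = ∫⁻ y, ∫⁻ g : O n, f (g.1 * standardFrame hk * y) *
          ENNReal.ofReal (gramVolume y ^ n) ∂haarO n ∂invariantVolume k q :=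
          lintegral_lintegral_swap hG.aemeasurable
      _ = ck * ∫⁻ h : O k, ∫⁻ A : Matrix (Fin q) (Fin q) ℝ, ∫⁻ g : O n,
          f (g.1 * standardFrame hk * (h.1 * standardFrame hq * A)) *
          ENNReal.ofReal (gramVolume A ^ n) ∂haarO n ∂invariantVolume q q ∂haarO k := by
          have hm : Measurable fun y : Matrix (Fin k) (Fin q) ℝ =>
              ∫⁻ g : O n, f (g.1 * standardFrame hk * y) *
              ENNReal.ofReal (gramVolume y ^ n) ∂haarO n :=
            hG.lintegral_prod_left' (μ := haarO n)
          have hm' : Measurable fun p : O k × Matrix (Fin q) (Fin q) ℝ =>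
              ∫⁻ g : O n, f (g.1 * standardFrame hk * (p.1.1 * standardFrame hq * p.2)) *
              ENNReal.ofReal (gramVolume (p.1.1 * standardFrame hq * p.2) ^ n) ∂haarO n :=
            hm.comp (measurable_polar hq)
          rw [hkm, lintegral_smul_measure, lintegral_map hm (measurable_polar hq), smul_eq_mul,
            lintegral_prod _ hm'.aemeasurable]
          simp only [gramVolume_congr (gram_polar _ _ _)]
      _ = ck * J := by
          simp only [hinner, lintegral_const, measure_univ, mul_one]
          rfl
  rw [hleft, hright, ← mul_assoc, ENNReal.div_mul_cancel hk0 hk']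

/-! ### Congruence substitutions on symmetric matrices -/

/-- The coordinates of a symmetric matrix, as the linear map reading off the entries on and above
the diagonal. It inverts `symmMatrix`. -/
def symmCoords (q : ℕ) : Matrix (Fin q) (Fin q) ℝ →ₗ[ℝ] Sym2 (Fin q) → ℝ where
  toFun M z := M z.inf z.sup
  map_add' _ _ := rfl
  map_smul' _ _ := rfl

theorem isSymm_symmMatrix {q : ℕ} (s : Sym2 (Fin q) → ℝ) : (symmMatrix s).IsSymm := by
  ext i j
  simp [symmMatrix, Sym2.eq_swap]

theorem symmCoords_symmMatrix {q : ℕ} (s : Sym2 (Fin q) → ℝ) : symmCoords q (symmMatrix s) = s := by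
  funext z
  exact congrArg s (Sym2.sortEquiv.symm_apply_apply z)

theorem symmMatrix_symmCoords {q : ℕ} {M : Matrix (Fin q) (Fin q) ℝ} (hM : M.IsSymm) :
    symmMatrix (symmCoords q M) = M := by
  ext i j
  change M (i ⊓ j) (i ⊔ j) = M i j
  rcases le_total i j with h | h
  · rw [inf_eq_left.mpr h, sup_eq_right.mpr h]
  · rw [inf_eq_right.mpr h, sup_eq_left.mpr h, hM.apply]

/-- The substitution `r ↦ Aᵀ r A` in the coordinates of the symmetric matrix `r`. -/
def symmCongr {q : ℕ} (A : Matrix (Fin q) (Fin q) ℝ) :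
    (Sym2 (Fin q) → ℝ) →ₗ[ℝ] Sym2 (Fin q) → ℝ where
  toFun s := symmCoords q (Aᵀ * symmMatrix s * A)
  map_add' s t := by
    have h : symmMatrix (s + t) = symmMatrix s + symmMatrix t := rfl
    rw [h, Matrix.mul_add, Matrix.add_mul, map_add]
  map_smul' c s := by
    have h : symmMatrix (c • s) = c • symmMatrix s := rfl
    rw [h, Matrix.mul_smul, Matrix.smul_mul, map_smul, RingHom.id_apply]

theorem symmCongr_apply {q : ℕ} (A : Matrix (Fin q) (Fin q) ℝ) (s : Sym2 (Fin q) → ℝ) :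
    symmCongr A s = symmCoords q (Aᵀ * symmMatrix s * A) := rfl

theorem symmMatrix_symmCongr {q : ℕ} (A : Matrix (Fin q) (Fin q) ℝ) (s : Sym2 (Fin q) → ℝ) :
    symmMatrix (symmCongr A s) = Aᵀ * symmMatrix s * A := by
  rw [symmCongr_apply, symmMatrix_symmCoords]
  rw [Matrix.IsSymm, Matrix.transpose_mul, Matrix.transpose_mul, Matrix.transpose_transpose,
    (isSymm_symmMatrix s).eq, Matrix.mul_assoc]

theorem symmCongr_mul_apply {q : ℕ} (A B : Matrix (Fin q) (Fin q) ℝ) (s : Sym2 (Fin q) → ℝ) :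
    symmCongr (A * B) s = symmCongr B (symmCongr A s) := by
  rw [symmCongr_apply B, symmMatrix_symmCongr, symmCongr_apply]
  simp only [Matrix.transpose_mul, Matrix.mul_assoc]

theorem symmCongr_mul {q : ℕ} (A B : Matrix (Fin q) (Fin q) ℝ) :
    symmCongr (A * B) = symmCongr B * symmCongr A :=
  LinearMap.ext (symmCongr_mul_apply A B)

theorem symmCongr_one_apply {q : ℕ} (s : Sym2 (Fin q) → ℝ) :
    symmCongr (1 : Matrix (Fin q) (Fin q) ℝ) s = s := by
  rw [symmCongr_apply, Matrix.transpose_one, Matrix.one_mul, Matrix.mul_one, symmCoords_symmMatrix]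

/-- The eigenvalues `d_i d_j`, `i ≤ j`, of `r ↦ D r D` for diagonal `D` have product
`(det D) ^ (q + 1)`. -/
theorem prod_sym2_inf_mul_sup {q : ℕ} (d : Fin q → ℝ) :
    ∏ z : Sym2 (Fin q), d z.inf * d z.sup = (∏ i, d i) ^ (q + 1) := by
  have h1 : ∏ z : Sym2 (Fin q), d z.inf * d z.sup =
      ∏ p : {p : Fin q × Fin q // p.1 ≤ p.2}, d p.1.1 * d p.1.2 :=
    Fintype.prod_equiv Sym2.sortEquiv _ _ fun _ => rfl
  have h2 : ∏ p : {p : Fin q × Fin q // p.1 ≤ p.2}, d p.1.1 * d p.1.2 =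
      ∏ i, ∏ j, if i ≤ j then d i * d j else 1 := by
    rw [← Fintype.prod_prod_type', ← Finset.prod_filter,
      ← Finset.prod_subtype (p := fun p : Fin q × Fin q => p.1 ≤ p.2)
        (Finset.univ.filter fun p => p.1 ≤ p.2) (by simp) (fun p => d p.1 * d p.2)]
  have h3 : ∏ i, ∏ j, (if i ≤ j then d i * d j else 1) =
      (∏ i, ∏ j, if i ≤ j then d i else 1) * ∏ i, ∏ j, if j ≤ i then d i else 1 := by
    conv_rhs =>
      rw [Finset.prod_comm (f := fun i j => if j ≤ i then d i else 1)]
    simp only [← Finset.prod_mul_distrib]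
    refine Finset.prod_congr rfl fun i _ => Finset.prod_congr rfl fun j _ => ?_
    split_ifs <;> simp
  rw [h1, h2, h3, ← Finset.prod_mul_distrib, ← Finset.prod_pow]
  refine Finset.prod_congr rfl fun i _ => ?_
  rw [← Finset.prod_filter, ← Finset.prod_filter, Finset.prod_const, Finset.prod_const, ← pow_add]
  congr 1
  have e1 : (Finset.univ.filter fun j => i ≤ j) = Finset.Ici i := by ext; simp
  have e2 : (Finset.univ.filter fun j => j ≤ i) = Finset.Iic i := by ext; simp
  rw [e1, e2, Fin.card_Ici, Fin.card_Iic]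
  omega

theorem det_symmCongr_diagonal {q : ℕ} (d : Fin q → ℝ) :
    LinearMap.det (symmCongr (Matrix.diagonal d)) = (Matrix.diagonal d).det ^ (q + 1) := by
  have h : symmCongr (Matrix.diagonal d) =
      Matrix.toLin' (Matrix.diagonal fun z : Sym2 (Fin q) => d z.inf * d z.sup) := by
    refine LinearMap.ext fun s => funext fun z => ?_
    rw [Matrix.toLin'_apply, Matrix.mulVec_diagonal]
    change ((Matrix.diagonal d)ᵀ * symmMatrix s * Matrix.diagonal d) z.inf z.sup = _
    rw [Matrix.diagonal_transpose, Matrix.mul_diagonal, Matrix.diagonal_mul]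
    have hz : symmMatrix s z.inf z.sup = s z := congrFun (symmCoords_symmMatrix s) z
    rw [hz]
    ring
  rw [h, LinearMap.det_toLin', Matrix.det_diagonal, prod_sym2_inf_mul_sup, Matrix.det_diagonal]

/-- The Jacobian of `r ↦ Aᵀ r A`. It is multiplicative in `A`, and equals `1` for a transvection
`T`, as `T ^ 2` is conjugate to `T`. -/
theorem det_symmCongr {q : ℕ} {A : Matrix (Fin q) (Fin q) ℝ} (hA : A.det ≠ 0) :
    LinearMap.det (symmCongr A) = A.det ^ (q + 1) := by
  have hmul : ∀ A B : Matrix (Fin q) (Fin q) ℝ, LinearMap.det (symmCongr (A * B)) =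
      LinearMap.det (symmCongr A) * LinearMap.det (symmCongr B) := fun A B => by
    rw [symmCongr_mul, map_mul, mul_comm]
  have hone : LinearMap.det (symmCongr (1 : Matrix (Fin q) (Fin q) ℝ)) = 1 := by
    have h : symmCongr (1 : Matrix (Fin q) (Fin q) ℝ) = 1 := LinearMap.ext symmCongr_one_apply
    rw [h, map_one]
  refine Matrix.diagonal_transvection_induction_of_det_ne_zero
    (fun A => LinearMap.det (symmCongr A) = A.det ^ (q + 1)) A hA
    (fun d _ => det_symmCongr_diagonal d) ?_ ?_
  · rintro ⟨i, j, hij, c⟩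
    rw [Matrix.TransvectionStruct.det, one_pow, Matrix.TransvectionStruct.toMatrix_mk]
    let D : Matrix (Fin q) (Fin q) ℝ := Matrix.diagonal (Function.update 1 i 2)
    let D' : Matrix (Fin q) (Fin q) ℝ := Matrix.diagonal (Function.update 1 i 2⁻¹)
    have hDD : D * D' = 1 := by
      rw [Matrix.diagonal_mul_diagonal, ← Matrix.diagonal_one]
      congr 1
      funext a
      by_cases ha : a = i
      · subst ha; simp
      · simp [ha]
    -- the matrix `D` conjugates the transvection `1 + c E_ij` into `1 + 2 c E_ij`, its square
    have hconj : D * Matrix.transvection i j c * D' =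
        Matrix.transvection i j c * Matrix.transvection i j c := by
      rw [Matrix.transvection_mul_transvection_same _ _ hij]
      have h1 : Matrix.transvection i j c = 1 + Matrix.single i j c := rfl
      have h2 : Matrix.transvection i j (c + c) = 1 + Matrix.single i j (c + c) := rfl
      rw [h1, h2, Matrix.mul_add, Matrix.mul_one, Matrix.add_mul, hDD]
      congr 1
      ext a b
      rw [Matrix.mul_diagonal, Matrix.diagonal_mul, Matrix.single_apply, Matrix.single_apply]
      split_ifs with h
      · obtain ⟨rfl, rfl⟩ := h
        simp [Function.update_of_ne hij.symm]
        ring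
      · simp
    have h1 := congrArg (fun M => LinearMap.det (symmCongr M)) hconj
    have h2 := congrArg (fun M => LinearMap.det (symmCongr M)) hDD
    have h3 : Matrix.transvection i j c * Matrix.transvection i j (-c) = 1 := by
      rw [Matrix.transvection_mul_transvection_same _ _ hij, add_neg_cancel,
        Matrix.transvection_zero]
    have h4 := congrArg (fun M => LinearMap.det (symmCongr M)) h3
    simp only [hmul, hone] at h1 h2 h4
    have hne : LinearMap.det (symmCongr (Matrix.transvection i j c)) ≠ 0 :=
      left_ne_zero_of_mul_eq_one h4
    refine mul_left_cancel₀ hne ?_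
    rw [← h1, mul_one]
    linear_combination LinearMap.det (symmCongr (Matrix.transvection i j c)) * h2
  · intro A B _ _ h1 h2
    rw [hmul, h1, h2, Matrix.det_mul, mul_pow]

theorem continuous_symmMatrix {q : ℕ} : Continuous (symmMatrix (q := q)) :=
  continuous_matrix fun _ _ => continuous_apply _

theorem continuous_symmCoords {q : ℕ} : Continuous (symmCoords q) :=
  continuous_pi fun _ => continuous_id.matrix_elem _ _

/-! ### The cone of positive definite matrices -/

theorem isHermitian_symmMatrix {q : ℕ} (s : Sym2 (Fin q) → ℝ) : (symmMatrix s).IsHermitian := by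
  rw [Matrix.IsHermitian, Matrix.conjTranspose_eq_transpose_of_trivial, (isSymm_symmMatrix s).eq]

theorem measurableSet_posDef (q : ℕ) :
    MeasurableSet {s : Sym2 (Fin q) → ℝ | (symmMatrix s).PosDef} := by
  have h : {s : Sym2 (Fin q) → ℝ | (symmMatrix s).PosDef} =
      (⋂ v : Fin q → ℝ, {s | 0 ≤ star v ⬝ᵥ (symmMatrix s *ᵥ v)}) ∩
        {s | (symmMatrix s).det ≠ 0} := by
    ext s
    simp only [Set.mem_inter_iff, Set.mem_iInter]
    constructor
    · exact fun hs => ⟨fun v => hs.posSemidef.dotProduct_mulVec_nonneg v, hs.det_pos.ne'⟩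
    · rintro ⟨h1, h2⟩
      exact (Matrix.PosSemidef.of_dotProduct_mulVec_nonneg (isHermitian_symmMatrix s)
        h1).posDef_iff_det_ne_zero.mpr h2
  rw [h]
  refine MeasurableSet.inter ?_ ?_
  · refine (isClosed_iInter fun v => isClosed_le continuous_const ?_).measurableSet
    exact continuous_const.dotProduct (continuous_symmMatrix.matrix_mulVec continuous_const)
  · exact (isOpen_ne_fun continuous_symmMatrix.matrix_det continuous_const).measurableSet

/-- Adding a large multiple of the identity makes a symmetric matrix positive definite, so
countably many translates of the positive definite cone cover the space of symmetric matrices. -/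
theorem exists_nat_posDef_add {q : ℕ} (s : Sym2 (Fin q) → ℝ) :
    ∃ m : ℕ, (symmMatrix (s + (m : ℝ) • symmCoords q 1)).PosDef := by
  obtain ⟨m, hm⟩ := exists_nat_gt (∑ i, ∑ j, |symmMatrix s i j|)
  refine ⟨m, Matrix.PosDef.of_dotProduct_mulVec_pos (isHermitian_symmMatrix _) fun v hv => ?_⟩
  have h1 : symmMatrix (s + (m : ℝ) • symmCoords q 1) = symmMatrix s + (m : ℝ) • 1 :=
    congrArg (fun M => symmMatrix s + (m : ℝ) • M) (symmMatrix_symmCoords Matrix.isSymm_one)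
  have hS : 0 < v ⬝ᵥ v := by
    simpa using Matrix.dotProduct_star_self_pos_iff.mpr hv
  have hsq : ∀ i, v i ^ 2 ≤ v ⬝ᵥ v := fun i => by
    rw [pow_two]
    exact Finset.single_le_sum (f := fun i => v i * v i) (fun i _ => mul_self_nonneg _)
      (Finset.mem_univ i)
  have hsum : -(∑ i, ∑ j, |symmMatrix s i j|) * (v ⬝ᵥ v) ≤ v ⬝ᵥ (symmMatrix s *ᵥ v) := by
    have he : v ⬝ᵥ (symmMatrix s *ᵥ v) = ∑ i, ∑ j, v i * (symmMatrix s i j * v j) := by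
      simp only [dotProduct, Matrix.mulVec, Finset.mul_sum]
    rw [he, neg_mul, Finset.sum_mul, ← Finset.sum_neg_distrib]
    refine Finset.sum_le_sum fun i _ => ?_
    rw [Finset.sum_mul, ← Finset.sum_neg_distrib]
    refine Finset.sum_le_sum fun j _ => ?_
    have hij : |v i * v j| ≤ v ⬝ᵥ v := by
      rw [abs_le]
      constructor <;> nlinarith [hsq i, hsq j, sq_nonneg (v i + v j), sq_nonneg (v i - v j)]
    calc -(|symmMatrix s i j| * (v ⬝ᵥ v)) ≤ -(|symmMatrix s i j| * |v i * v j|) :=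
          neg_le_neg (mul_le_mul_of_nonneg_left hij (abs_nonneg _))
      _ = -|v i * (symmMatrix s i j * v j)| := by
          rw [← abs_mul]
          congr 2
          ring
      _ ≤ _ := neg_abs_le _
  rw [h1, Matrix.add_mulVec, dotProduct_add, Matrix.smul_mulVec, Matrix.one_mulVec, star_trivial,
    dotProduct_smul, smul_eq_mul]
  nlinarith

theorem volume_posDef_ne_zero (q : ℕ) :
    volume {s : Sym2 (Fin q) → ℝ | (symmMatrix s).PosDef} ≠ 0 := by
  intro h
  have hcov : (Set.univ : Set (Sym2 (Fin q) → ℝ)) ⊆ ⋃ m : ℕ,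
      (fun s => s + (m : ℝ) • symmCoords q 1) ⁻¹' {s | (symmMatrix s).PosDef} := by
    intro s _
    exact Set.mem_iUnion.mpr (exists_nat_posDef_add s)
  have hnull := measure_mono_null hcov (measure_iUnion_null fun m => by
    rw [measure_preimage_add_right volume, h])
  exact Measure.measure_univ_ne_zero.mpr (NeZero.ne volume) hnull

/-- The measure `(det r) ^ (-(q + 1) / 2) dr` on positive definite matrices, which is invariant
under `r ↦ Aᵀ r A` for `A ∈ GL_q`. -/
def posDefInvariantVolume (q : ℕ) : Measure (Sym2 (Fin q) → ℝ) :=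
  (volume.restrict {s | (symmMatrix s).PosDef}).withDensity
    fun s => ENNReal.ofReal (Real.sqrt (symmMatrix s).det ^ (q + 1))⁻¹

instance {q : ℕ} : SigmaFinite (posDefInvariantVolume q) :=
  SigmaFinite.withDensity_ofReal _

theorem measurable_sqrt_det {q : ℕ} (m : ℕ) :
    Measurable fun s : Sym2 (Fin q) → ℝ => Real.sqrt (symmMatrix s).det ^ m :=
  (continuous_symmMatrix.matrix_det.sqrt.pow m).measurable

theorem measurable_posDefDensity {q : ℕ} :
    Measurable fun s : Sym2 (Fin q) → ℝ =>
      ENNReal.ofReal (Real.sqrt (symmMatrix s).det ^ (q + 1))⁻¹ :=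
  (measurable_sqrt_det (q + 1)).inv.ennreal_ofReal

theorem ae_posDef (q : ℕ) :
    ∀ᵐ s ∂posDefInvariantVolume q, (symmMatrix s).PosDef :=
  (withDensity_absolutelyContinuous _ _).ae_le (ae_restrict_mem (measurableSet_posDef q))

theorem posDefInvariantVolume_ne_zero (q : ℕ) : posDefInvariantVolume q ≠ 0 := by
  intro h
  have hac : volume.restrict {s : Sym2 (Fin q) → ℝ | (symmMatrix s).PosDef} ≪
      posDefInvariantVolume q := by
    refine withDensity_absolutelyContinuous' measurable_posDefDensity.aemeasurable ?_
    filter_upwards [ae_restrict_mem (measurableSet_posDef q)] with s hs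
    exact (ENNReal.ofReal_pos.mpr (inv_pos.mpr (pow_pos (Real.sqrt_pos.mpr
      (Matrix.PosDef.det_pos hs)) _))).ne'
  rw [h, Measure.absolutelyContinuous_zero_iff, Measure.restrict_eq_zero] at hac
  exact volume_posDef_ne_zero q hac

theorem posDef_symmCongr_iff {q : ℕ} {A : Matrix (Fin q) (Fin q) ℝ} (hA : A.det ≠ 0)
    (s : Sym2 (Fin q) → ℝ) :
    (symmMatrix (symmCongr A s)).PosDef ↔ (symmMatrix s).PosDef := by
  have hu : IsUnit A := (Matrix.isUnit_iff_isUnit_det _).mpr (isUnit_iff_ne_zero.mpr hA)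
  rw [symmMatrix_symmCongr]
  have h := Matrix.IsUnit.posDef_star_left_conjugate_iff (x := symmMatrix s) hu
  rwa [Matrix.star_eq_conjTranspose, Matrix.conjTranspose_eq_transpose_of_trivial] at h

theorem map_posDefInvariantVolume {q : ℕ} {A : Matrix (Fin q) (Fin q) ℝ} (hA : A.det ≠ 0) :
    (posDefInvariantVolume q).map (symmCongr A) = posDefInvariantVolume q := by
  have hm : Measurable (symmCongr A) := (LinearMap.continuous_of_finiteDimensional _).measurable
  refine map_withDensity_eq_self hm measurable_posDefDensity
    (ofReal_pow_mul_ofReal_inv_pow hA (q + 1)) ?_ fun s => ?_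
  · have hP : (symmCongr A) ⁻¹' {s : Sym2 (Fin q) → ℝ | (symmMatrix s).PosDef} =
        {s | (symmMatrix s).PosDef} := Set.ext fun s => posDef_symmCongr_iff hA s
    conv_lhs => rw [← hP]
    have hdet : LinearMap.det (symmCongr A) ≠ 0 := by
      rw [det_symmCongr hA]
      exact pow_ne_zero _ hA
    rw [← Measure.restrict_map hm (measurableSet_posDef q),
      Measure.map_linearMap_addHaar_eq_smul_addHaar volume hdet, Measure.restrict_smul,
      det_symmCongr hA, ← inv_pow, abs_pow, ENNReal.ofReal_pow (abs_nonneg _)]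
  · have h : (Aᵀ * symmMatrix s * A).det = A.det ^ 2 * (symmMatrix s).det := by
      rw [Matrix.det_mul, Matrix.det_mul, Matrix.det_transpose]
      ring
    rw [symmMatrix_symmCongr, h, Real.sqrt_mul (sq_nonneg _), Real.sqrt_sq_eq_abs,
      ← ENNReal.ofReal_mul (by positivity), mul_pow, mul_inv, ← mul_assoc,
      mul_inv_cancel₀ (pow_ne_zero _ (abs_ne_zero.mpr hA)), one_mul]

/-! ### The Siegel gamma function as a moment of the Gaussian -/

/-- The function `exp (- tr r) (det r) ^ (m / 2)`. -/
def symmGaussian {q : ℕ} (m : ℕ) (s : Sym2 (Fin q) → ℝ) : ℝ≥0∞ :=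
  ENNReal.ofReal (Real.exp (-(symmMatrix s).trace)) *
    ENNReal.ofReal (Real.sqrt (symmMatrix s).det ^ m)

theorem measurable_symmGaussian {q : ℕ} (m : ℕ) : Measurable (symmGaussian (q := q) m) :=
  (Real.continuous_exp.comp continuous_symmMatrix.matrix_trace.neg).measurable.ennreal_ofReal.mul
    (measurable_sqrt_det m).ennreal_ofReal

theorem measurable_symmCongr (q : ℕ) : Measurable fun p : Matrix (Fin q) (Fin q) ℝ ×
    (Sym2 (Fin q) → ℝ) => symmCongr p.1 p.2 :=
  (continuous_symmCoords.comp ((continuous_fst.matrix_transpose.matrix_mul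
    (continuous_symmMatrix.comp continuous_snd)).matrix_mul continuous_fst)).measurable

theorem measurable_symmCongr_inv (q : ℕ) : Measurable fun p : Matrix (Fin q) (Fin q) ℝ ×
    (Sym2 (Fin q) → ℝ) => symmCongr p.1⁻¹ p.2 := by
  have hinv : Measurable fun p : Matrix (Fin q) (Fin q) ℝ × (Sym2 (Fin q) → ℝ) => p.1⁻¹ :=
    measurable_matrix_inv.comp measurable_fst
  have h := (measurable_symmCongr q).comp (hinv.prodMk measurable_snd)
  exact h

theorem symmGaussian_symmCongr_one {q : ℕ} (m : ℕ) (A : Matrix (Fin q) (Fin q) ℝ) :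
    symmGaussian m (symmCongr A (symmCoords q 1)) =
      gaussian A * ENNReal.ofReal (gramVolume A ^ m) := by
  rw [symmGaussian, symmMatrix_symmCongr, symmMatrix_symmCoords Matrix.isSymm_one, Matrix.mul_one]
  rfl

/-- The invariant measure on positive definite matrices is proportional to the image of the Haar
measure of `GL_q` under `A ↦ Aᵀ A`. -/
theorem exists_lintegral_symmGaussian (q : ℕ) : ∃ κ : ℝ≥0∞, κ ≠ 0 ∧ κ ≠ ∞ ∧ ∀ m : ℕ,
    ∫⁻ s, symmGaussian m s ∂posDefInvariantVolume q = κ * gaussianMoment q m := by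
  have hact := measurable_symmCongr q
  have hact' := measurable_symmCongr_inv q
  have hx := hact.comp (measurable_prodMk_right (y := symmCoords q 1))
  have hx' := hact'.comp (measurable_prodMk_right (y := symmCoords q 1))
  rw [Function.comp_def] at hx hx'
  have hpolar : ∀ s : Sym2 (Fin q) → ℝ, (symmMatrix s).PosDef →
      ∃ B : Matrix (Fin q) (Fin q) ℝ, B.det ≠ 0 ∧ s = symmCongr B (symmCoords q 1) := by
    intro s hs
    obtain ⟨B, hB, h⟩ := exists_transpose_mul_self_eq hs
    refine ⟨B, hB, ?_⟩
    rw [← symmCoords_symmMatrix s, ← symmCoords_symmMatrix (symmCongr B _), symmMatrix_symmCongr,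
      symmMatrix_symmCoords Matrix.isSymm_one, Matrix.mul_one, h]
  have hπ : ∫⁻ A, symmGaussian q (symmCongr A (symmCoords q 1)) ∂invariantVolume q q =
      ENNReal.ofReal (Real.pi ^ ((q : ℝ) * (q : ℝ) / 2)) := by
    simp only [symmGaussian_symmCongr_one]
    exact gaussianMoment_self q
  obtain ⟨κ, h0, h1, h⟩ := exists_eq_smul_map_of_transitive (γ := invariantVolume q q)
    (act := fun A s => symmCongr A s) (act' := fun A s => symmCongr A⁻¹ s) (f₀ := symmGaussian q)
    (posDefInvariantVolume_ne_zero q) hact hact' (symmCoords q 1)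
    ((ae_posDef q).mono fun s hs => by
      obtain ⟨B, hB, rfl⟩ := hpolar s hs
      have hL : Measurable fun A : Matrix (Fin q) (Fin q) ℝ => B * A :=
        (continuous_const.matrix_mul continuous_id).measurable
      conv_rhs => rw [← map_mul_left_invariantVolume hB]
      refine Eq.trans ?_ (Measure.map_map hx hL).symm
      congr 1
      funext A
      exact (symmCongr_mul_apply B A _).symm)
    ((ae_posDef q).mono fun s hs => by
      obtain ⟨B, hB, rfl⟩ := hpolar s hs
      have hB' : B⁻¹.det ≠ 0 := by
        rw [Matrix.det_nonsing_inv, Ring.inverse_eq_inv']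
        exact inv_ne_zero hB
      have hR : Measurable fun A : Matrix (Fin q) (Fin q) ℝ => A * B⁻¹ :=
        (continuous_id.matrix_mul continuous_const).measurable
      conv_rhs => rw [← map_mul_right_invariantVolume hB']
      refine Eq.trans ?_ (Measure.map_map hx' hR).symm
      congr 1
      funext A
      simp only [Function.comp_apply, Matrix.mul_inv_rev,
        Matrix.nonsing_inv_nonsing_inv _ (isUnit_iff_ne_zero.mpr hB), symmCongr_mul_apply])
    (ae_det_ne_zero.mono fun A hA => map_posDefInvariantVolume hA)
    (ae_det_ne_zero.mono fun A hA s => by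
      rw [← symmCongr_mul_apply, Matrix.mul_nonsing_inv _ (isUnit_iff_ne_zero.mpr hA),
        symmCongr_one_apply])
    (measurable_symmGaussian q)
    ((ae_posDef q).mono fun s hs => mul_ne_zero (ENNReal.ofReal_pos.mpr (Real.exp_pos _)).ne'
      (ENNReal.ofReal_pos.mpr (pow_pos (Real.sqrt_pos.mpr hs.det_pos) _)).ne')
    (hπ.trans_ne (ENNReal.ofReal_pos.mpr (Real.rpow_pos_of_pos Real.pi_pos _)).ne')
    (hπ.trans_ne ENNReal.ofReal_ne_top)
  refine ⟨κ, h0, h1, fun m => ?_⟩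
  rw [h, lintegral_smul_measure, smul_eq_mul,
    lintegral_map (measurable_symmGaussian m) hx]
  congr 1
  exact lintegral_congr fun A => symmGaussian_symmCongr_one m A

theorem siegelGamma_eq_toReal (q n : ℕ) : siegelGamma q ((n : ℝ) / 2) =
    (∫⁻ s, symmGaussian n s ∂posDefInvariantVolume q).toReal := by
  have hmeas : Measurable fun s : Sym2 (Fin q) → ℝ => Real.exp (-(symmMatrix s).trace) *
      |(symmMatrix s).det| ^ ((n : ℝ) / 2 - ((q : ℝ) + 1) / 2) :=
    (Real.continuous_exp.comp continuous_symmMatrix.matrix_trace.neg).measurable.mul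
      (continuous_symmMatrix.matrix_det.abs.measurable.pow_const _)
  rw [siegelGamma, integral_eq_lintegral_of_nonneg_ae
    (Filter.Eventually.of_forall fun s => by positivity) hmeas.aestronglyMeasurable,
    posDefInvariantVolume, lintegral_withDensity_apply _
      measurable_posDefDensity (measurable_symmGaussian n)]
  congr 1
  refine setLIntegral_congr_fun (measurableSet_posDef q) fun s hs => ?_
  have hdet : 0 < (symmMatrix s).det := Matrix.PosDef.det_pos hs
  rw [symmGaussian, mul_left_comm, ← ENNReal.ofReal_mul (by positivity),
    ← ENNReal.ofReal_mul (by positivity), abs_of_pos hdet, Real.rpow_sub hdet]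
  have hp : ∀ m : ℕ, Real.sqrt (symmMatrix s).det ^ m = (symmMatrix s).det ^ ((m : ℝ) / 2) := by
    intro m
    rw [Real.sqrt_eq_rpow, ← Real.rpow_natCast, ← Real.rpow_mul hdet.le]
    congr 1
    ring
  rw [hp, hp]
  push_cast
  rw [div_eq_inv_mul]

/-! ### Borel structure of the Grassmannian -/

instance (n : ℕ) : StandardBorelSpace (O n) := by
  have hP : PolishSpace (Matrix (Fin n) (Fin n) ℝ) :=
    inferInstanceAs (PolishSpace (Fin n → Fin n → ℝ))
  have hO : PolishSpace (O n) :=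
    (isClosed_unitary (R := Matrix (Fin n) (Fin n) ℝ)).polishSpace
  infer_instance

theorem isEmbedding_starProjection (n k : ℕ) : Topology.IsEmbedding
    fun ξ : Grassmannian n k => ξ.1.starProjection := by
  refine ⟨⟨rfl⟩, fun ξ η h => Subtype.ext ?_⟩
  have h' : ξ.1.starProjection = η.1.starProjection := h
  rw [← Submodule.range_starProjection ξ.1, h', Submodule.range_starProjection]

instance (n k : ℕ) : MeasurableSpace.CountablySeparated (Grassmannian n k) := by
  have h1 := (isEmbedding_starProjection n k).secondCountableTopology
  have h2 := (isEmbedding_starProjection n k).t2Space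
  infer_instance

theorem mem_smul_coordPlane {n k : ℕ} (hk : k ≤ n) (g : O n) (v : Fin k → ℝ) :
    WithLp.toLp 2 ((g.1 * standardFrame hk) *ᵥ v) ∈ (g • coordPlane hk).1 := by
  refine ⟨WithLp.toLp 2 (standardFrame hk *ᵥ v), ?_, ?_⟩
  · have h : WithLp.toLp 2 (standardFrame hk *ᵥ v) =
        ∑ j, v j • EuclideanSpace.single (Fin.castLE hk j) (1 : ℝ) := by
      ext i
      simp [standardFrame, Matrix.mulVec, dotProduct, Matrix.one_apply, mul_comm, Pi.single_apply]
    rw [h]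
    exact Submodule.sum_mem _ fun j _ =>
      Submodule.smul_mem _ _ (Submodule.subset_span (Set.mem_range_self j))
  · change toIsometry g _ = _
    rw [toIsometry_apply, Matrix.mulVec_mulVec]

/-- `O(n)` acts transitively on the Grassmannian. -/
theorem surjective_smul_coordPlane {n k : ℕ} (hk : k ≤ n) :
    Function.Surjective fun g : O n => g • coordPlane hk := by
  intro ξ
  let b : OrthonormalBasis (Fin k) ℝ ξ.1 := (stdOrthonormalBasis ℝ ξ.1).reindex (finCongr ξ.2)
  let z : Matrix (Fin n) (Fin k) ℝ := Matrix.of fun i j => (b j : EuclideanSpace ℝ (Fin n)) i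
  have hz : zᵀ * z = 1 := by
    ext i j
    have h := orthonormal_iff_ite.mp b.orthonormal i j
    rw [Submodule.coe_inner, PiLp.inner_apply] at h
    rw [Matrix.one_apply, ← h, Matrix.mul_apply]
    exact Finset.sum_congr rfl fun r _ => mul_comm _ _
  obtain ⟨g, hg⟩ := exists_orthogonal_mul_standardFrame hk hz
  refine ⟨g, Subtype.ext (Submodule.eq_of_le_of_finrank_eq ?_ ?_).symm⟩
  · intro x hx
    have h := b.sum_repr ⟨x, hx⟩
    have hx' : x = WithLp.toLp 2 (z *ᵥ fun j => b.repr ⟨x, hx⟩ j) := by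
      have h' := congrArg (fun y : ξ.1 => (y : EuclideanSpace ℝ (Fin n))) h
      simp only [Submodule.coe_sum, Submodule.coe_smul] at h'
      refine h'.symm.trans ?_
      ext i
      simp only [WithLp.ofLp_sum, WithLp.ofLp_smul, Finset.sum_apply, Pi.smul_apply, smul_eq_mul]
      exact Finset.sum_congr rfl fun j _ => mul_comm _ _
    rw [hx', ← hg]
    exact mem_smul_coordPlane hk g _
  · rw [ξ.2, (g • coordPlane hk).2]

/-! ### Lebesgue measure on `ξ ^ q` -/

theorem measurePreserving_ofColumns {k q : ℕ} :
    MeasurePreserving (ofColumns : (Fin q → EuclideanSpace ℝ (Fin k)) → _) := by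
  have h := volume_preserving_pi (fun _ : Fin q => PiLp.volume_preserving_ofLp (Fin k))
  exact (measurePreserving_transpose (ι := Fin q) (κ := Fin k)).comp h

theorem continuous_ofColumns_coe {n q : ℕ} (ξ : Submodule ℝ (EuclideanSpace ℝ (Fin n))) :
    Continuous fun y : Fin q → ξ => ofColumns fun j => (y j : EuclideanSpace ℝ (Fin n)) :=
  continuous_matrix fun i j => (PiLp.continuous_apply 2 _ i).comp
    (continuous_subtype_val.comp (continuous_apply j))

theorem measurableEmbedding_ofColumns_coe {n q : ℕ} (ξ : Submodule ℝ (EuclideanSpace ℝ (Fin n))) :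
    MeasurableEmbedding
      fun y : Fin q → ξ => ofColumns fun j => (y j : EuclideanSpace ℝ (Fin n)) := by
  refine (continuous_ofColumns_coe ξ).measurableEmbedding fun y y' h => ?_
  funext j
  refine Subtype.ext ?_
  ext i
  exact congrFun (congrFun h i) j

/-- Lebesgue measure on `ξ ^ q` in terms of a matrix `z` whose columns form an orthonormal basis
of `ξ`. -/
theorem map_ofColumns_coe_eq_map_mul {n k q : ℕ} {ξ : Submodule ℝ (EuclideanSpace ℝ (Fin n))}
    (L : EuclideanSpace ℝ (Fin k) →ₗᵢ[ℝ] EuclideanSpace ℝ (Fin n))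
    (hL : LinearMap.range L.toLinearMap = ξ) {z : Matrix (Fin n) (Fin k) ℝ}
    (hz : ∀ v, L v = WithLp.toLp 2 (z *ᵥ WithLp.ofLp v)) :
    (volume : Measure (Fin q → ξ)).map
        (fun y => ofColumns fun j => (y j : EuclideanSpace ℝ (Fin n))) =
      (volume : Measure (Matrix (Fin k) (Fin q) ℝ)).map fun y => z * y := by
  subst hL
  have he := volume_preserving_pi (fun _ : Fin q => L.equivRange.measurePreserving)
  have hz' : Measurable fun y : Matrix (Fin k) (Fin q) ℝ => z * y :=
    (continuous_const.matrix_mul continuous_id).measurable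
  rw [← he.map_eq, ← measurePreserving_ofColumns.map_eq,
    Measure.map_map (continuous_ofColumns_coe _).measurable he.measurable,
    Measure.map_map hz' measurePreserving_ofColumns.measurable]
  congr 1
  funext y
  ext i j
  have h : ((L.equivRange (y j) : LinearMap.range L.toLinearMap) : EuclideanSpace ℝ (Fin n)) =
      L (y j) := rfl
  change ((L.equivRange (y j) : LinearMap.range L.toLinearMap) : EuclideanSpace ℝ (Fin n)) i = _
  rw [h, hz]
  rfl

theorem map_ofColumns_smul_coordPlane {n k q : ℕ} (hk : k ≤ n) (g : O n) :
    (volume : Measure (Fin q → (g • coordPlane hk).1)).map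
        (fun y => ofColumns fun j => (y j : EuclideanSpace ℝ (Fin n))) =
      (volume : Measure (Matrix (Fin k) (Fin q) ℝ)).map fun y => g.1 * standardFrame hk * y := by
  let z := g.1 * standardFrame hk
  have hzz : zᵀ * z = 1 := by
    rw [gram_orthogonal_mul', transpose_standardFrame_mul_self]
  let L : EuclideanSpace ℝ (Fin k) →ₗᵢ[ℝ] EuclideanSpace ℝ (Fin n) :=
    { toLinearMap := Matrix.toLpLin 2 2 z
      norm_map' := fun v => by
        have h : (z *ᵥ WithLp.ofLp v) ⬝ᵥ (z *ᵥ WithLp.ofLp v) =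
            WithLp.ofLp v ⬝ᵥ WithLp.ofLp v := by
          rw [Matrix.dotProduct_mulVec, Matrix.vecMul_mulVec, hzz, Matrix.vecMul_one]
        change ‖WithLp.toLp 2 (z *ᵥ WithLp.ofLp v)‖ = ‖v‖
        rw [← sq_eq_sq₀ (norm_nonneg _) (norm_nonneg _), EuclideanSpace.real_norm_sq_eq,
          EuclideanSpace.real_norm_sq_eq]
        simpa only [dotProduct, ← pow_two] using h }
  refine map_ofColumns_coe_eq_map_mul L ?_ fun v => rfl
  refine Submodule.eq_of_le_of_finrank_eq ?_ ?_
  · rintro _ ⟨v, rfl⟩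
    exact mem_smul_coordPlane hk g (WithLp.ofLp v)
  · rw [LinearMap.finrank_range_of_inj L.injective, finrank_euclideanSpace_fin,
      (g • coordPlane hk).2]

/-! ### Disintegration over the Grassmannian -/

/-- The measure `|x|_q ^ (n - k) d_ξ x` on `ξ ^ q`, viewed as a measure on `n × q` matrices. -/
def fiberMeasure {n k : ℕ} (q : ℕ) (ξ : Grassmannian n k) : Measure (Matrix (Fin n) (Fin q) ℝ) :=
  ((volume : Measure (Fin q → ξ.1)).map
    fun y => ofColumns fun j => (y j : EuclideanSpace ℝ (Fin n))).withDensity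
      fun x => ENNReal.ofReal (gramVolume x ^ (n - k))

theorem measurable_gramVolume_pow {n q : ℕ} (m : ℕ) :
    Measurable fun x : Matrix (Fin n) (Fin q) ℝ => ENNReal.ofReal (gramVolume x ^ m) :=
  (measurable_gramVolume.pow_const m).ennreal_ofReal

theorem lintegral_fiberMeasure_smul {n k q : ℕ} (hk : k ≤ n) (g : O n)
    {f : Matrix (Fin n) (Fin q) ℝ → ℝ≥0∞} (hf : Measurable f) :
    ∫⁻ x, f x ∂fiberMeasure q (g • coordPlane hk) =
      ∫⁻ y : Matrix (Fin k) (Fin q) ℝ, f (g.1 * standardFrame hk * y) *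
        ENNReal.ofReal (gramVolume y ^ (n - k)) := by
  have hz : Measurable fun y : Matrix (Fin k) (Fin q) ℝ => g.1 * standardFrame hk * y :=
    (continuous_const.matrix_mul continuous_id).measurable
  have hgram : ∀ y : Matrix (Fin k) (Fin q) ℝ,
      gramVolume (g.1 * standardFrame hk * y) = gramVolume y := fun y =>
    gramVolume_congr (by rw [Matrix.mul_assoc, gram_orthogonal_mul', gram_standardFrame_mul])
  rw [fiberMeasure, map_ofColumns_smul_coordPlane,
    lintegral_withDensity_apply _ (measurable_gramVolume_pow _) hf,
    lintegral_map (f := fun x => ENNReal.ofReal (gramVolume x ^ (n - k)) * f x)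
      ((measurable_gramVolume_pow _).mul hf) hz]
  simp only [hgram, mul_comm]

theorem measurable_fiberMeasure {n k : ℕ} (hk : k ≤ n) (q : ℕ) :
    Measurable (fiberMeasure (n := n) (k := k) q) := by
  -- a map on the Grassmannian is measurable if its composition with `O(n) → G_{n,k}` is
  rw [← (measurable_smul_coordPlane hk).measurable_comp_iff_of_surjective
    (surjective_smul_coordPlane hk)]
  refine Measure.measurable_of_measurable_coe _ fun s hs => ?_
  have h : (fun g : O n => (fiberMeasure q ∘ fun g => g • coordPlane hk) g s) = fun g =>
      ∫⁻ y : Matrix (Fin k) (Fin q) ℝ, s.indicator 1 (g.1 * standardFrame hk * y) *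
        ENNReal.ofReal (gramVolume y ^ (n - k)) := by
    funext g
    rw [← lintegral_fiberMeasure_smul hk g (measurable_one.indicator hs),
      lintegral_indicator_one hs]
    rfl
  rw [h]
  have hact : Measurable fun p : O n × Matrix (Fin k) (Fin q) ℝ =>
      p.1.1 * standardFrame hk * p.2 :=
    (((continuous_subtype_val.comp continuous_fst).matrix_mul continuous_const).matrix_mul
      continuous_snd).measurable
  exact (((measurable_one.indicator hs).comp hact).mul
    ((measurable_gramVolume_pow _).comp measurable_snd)).lintegral_prod_right'

/-- The measures `|x|_q ^ (n - k) d_ξ x`, as a kernel on the Grassmannian. -/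
def fiberKernel {n k : ℕ} (hk : k ≤ n) (q : ℕ) :
    ProbabilityTheory.Kernel (Grassmannian n k) (Matrix (Fin n) (Fin q) ℝ) :=
  ⟨fiberMeasure q, measurable_fiberMeasure hk q⟩

theorem fiberKernel_apply {n k : ℕ} (hk : k ≤ n) (q : ℕ) (ξ : Grassmannian n k) :
    fiberKernel hk q ξ = fiberMeasure q ξ := rfl

theorem gaussianMoment_ne_zero_ne_top {n q : ℕ} (hq : q ≤ n) :
    gaussianMoment q n ≠ 0 ∧ gaussianMoment q n ≠ ∞ := by
  obtain ⟨c, h0, -, h, -⟩ := exists_invariantVolume_eq_polar hq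
  have hπ : ENNReal.ofReal (Real.pi ^ ((n : ℝ) * (q : ℝ) / 2)) ≠ 0 :=
    (ENNReal.ofReal_pos.mpr (Real.rpow_pos_of_pos Real.pi_pos _)).ne'
  constructor
  · intro hz
    rw [hz, mul_zero] at h
    exact hπ h.symm
  · intro hz
    rw [hz, ENNReal.mul_top h0] at h
    exact ENNReal.ofReal_ne_top h.symm

/-- Lebesgue measure on matrices is, up to the constant `σ_{n,q} / σ_{k,q}`, the mixture of the
measures `|x|_q ^ (n - k) d_ξ x` over the Grassmannian. -/
theorem exists_volume_eq_smul_comp {n k q : ℕ} (hq : q ≤ k) (hk : k ≤ n) :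
    ∃ C : ℝ≥0∞, C ≠ 0 ∧ C ≠ ∞ ∧ C.toReal = stiefelVolume n q / stiefelVolume k q ∧
      (volume : Measure (Matrix (Fin n) (Fin q) ℝ)) =
        C • (grassmannMeasure hk).bind (fiberKernel hk q) := by
  obtain ⟨C, hC0, hC, hCeq, hCint⟩ := exists_lintegral_rotated_frame hq hk
  refine ⟨C, hC0, hC, ?_, Measure.ext_of_lintegral _ fun f hf => ?_⟩
  · obtain ⟨κ, hκ0, hκ, hκeq⟩ := exists_lintegral_symmGaussian q
    obtain ⟨hn0, hn⟩ := gaussianMoment_ne_zero_ne_top (hq.trans hk)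
    obtain ⟨hk0, hk'⟩ := gaussianMoment_ne_zero_ne_top hq
    have h := congrArg ENNReal.toReal hCeq
    simp only [ENNReal.toReal_mul, ENNReal.toReal_ofReal
      (Real.rpow_nonneg Real.pi_pos.le _)] at h
    have p1 := ENNReal.toReal_pos hn0 hn
    have p2 := ENNReal.toReal_pos hk0 hk'
    have p3 := ENNReal.toReal_pos hκ0 hκ
    have p4 := Real.rpow_pos_of_pos Real.pi_pos ((k : ℝ) * (q : ℝ) / 2)
    rw [stiefelVolume, stiefelVolume, siegelGamma_eq_toReal, siegelGamma_eq_toReal, hκeq, hκeq,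
      ENNReal.toReal_mul, ENNReal.toReal_mul]
    generalize Real.pi ^ ((k : ℝ) * (q : ℝ) / 2) = a at *
    generalize Real.pi ^ ((n : ℝ) * (q : ℝ) / 2) = b at *
    field_simp
    linarith
  · have hf' : Measurable fun ξ => ∫⁻ x, f x ∂fiberKernel hk q ξ := hf.lintegral_kernel
    rw [lintegral_smul_measure, smul_eq_mul, Measure.lintegral_bind
      (ProbabilityTheory.Kernel.aemeasurable _) hf.aemeasurable, hCint f hf, grassmannMeasure,
      lintegral_map hf' (measurable_smul_coordPlane hk)]
    simp only [fiberKernel_apply, lintegral_fiberMeasure_smul hk _ hf]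

section Fiber

variable {𝕜 : Type*} [RCLike 𝕜] {n k q : ℕ}

theorem toReal_smul_gramVolume (F : Matrix (Fin n) (Fin q) ℝ → 𝕜) (m : ℕ)
    (x : Matrix (Fin n) (Fin q) ℝ) :
    (ENNReal.ofReal (gramVolume x ^ m)).toReal • F x = F x * ((gramVolume x ^ m : ℝ) : 𝕜) := by
  rw [ENNReal.toReal_ofReal (pow_nonneg (gramVolume_nonneg x) m), RCLike.real_smul_eq_coe_mul,
    mul_comm]

theorem integrable_fiberMeasure_iff (ξ : Grassmannian n k) (F : Matrix (Fin n) (Fin q) ℝ → 𝕜) :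
    Integrable F (fiberMeasure q ξ) ↔ Integrable fun y : Fin q → ξ.1 =>
      F (ofColumns fun j => (y j : EuclideanSpace ℝ (Fin n))) *
        ((gramVolume (ofColumns
          fun j => (y j : EuclideanSpace ℝ (Fin n))) ^ (n - k) : ℝ) : 𝕜) := by
  rw [fiberMeasure, integrable_withDensity_iff_integrable_smul' (measurable_gramVolume_pow _)
    (Filter.Eventually.of_forall fun _ => ENNReal.ofReal_lt_top),
    (measurableEmbedding_ofColumns_coe ξ.1).integrable_map_iff]
  simp only [Function.comp_def, toReal_smul_gramVolume]

theorem integral_fiberMeasure (ξ : Grassmannian n k) (F : Matrix (Fin n) (Fin q) ℝ → 𝕜) :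
    ∫ x, F x ∂fiberMeasure q ξ = ∫ y : Fin q → ξ.1,
      F (ofColumns fun j => (y j : EuclideanSpace ℝ (Fin n))) *
        ((gramVolume (ofColumns
          fun j => (y j : EuclideanSpace ℝ (Fin n))) ^ (n - k) : ℝ) : 𝕜) := by
  rw [fiberMeasure, integral_withDensity_eq_integral_toReal_smul (measurable_gramVolume_pow _)
    (Filter.Eventually.of_forall fun _ => ENNReal.ofReal_lt_top),
    (measurableEmbedding_ofColumns_coe ξ.1).integral_map]
  simp only [toReal_smul_gramVolume]

end Fiber

end

end BlaschkePetkantschin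

theorem theorem2p1 {𝕜 : Type*} [RCLike 𝕜] {n k q : ℕ} (hq : 1 ≤ q) (hqk : q ≤ k) (hkn : k ≤ n)
    (F : Matrix (Fin n) (Fin q) ℝ → 𝕜) (hF : Integrable F) :
    (∀ᵐ ξ ∂(grassmannMeasure hkn),
      Integrable fun y : Fin q → ξ.1 =>
        F (ofColumns fun j => (y j : EuclideanSpace ℝ (Fin n))) *
          ((gramVolume (ofColumns
            fun j => (y j : EuclideanSpace ℝ (Fin n))) ^ (n - k) : ℝ) : 𝕜)) ∧
    Integrable (fun ξ : Grassmannian n k =>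
      ∫ y : Fin q → ξ.1,
        F (ofColumns fun j => (y j : EuclideanSpace ℝ (Fin n))) *
          ((gramVolume (ofColumns
            fun j => (y j : EuclideanSpace ℝ (Fin n))) ^ (n - k) : ℝ) : 𝕜))
      (grassmannMeasure hkn) ∧
    ∫ x, F x =
      ((stiefelVolume n q / stiefelVolume k q : ℝ) : 𝕜) *
        ∫ ξ : Grassmannian n k,
          (∫ y : Fin q → ξ.1,
            F (ofColumns fun j => (y j : EuclideanSpace ℝ (Fin n))) *
              ((gramVolume (ofColumns
                fun j => (y j : EuclideanSpace ℝ (Fin n))) ^ (n - k) : ℝ) : 𝕜))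
          ∂(grassmannMeasure hkn) := by
  obtain ⟨C, hC0, hC, hCσ, hvol⟩ := exists_volume_eq_smul_comp hqk hkn
  have hcomp : Integrable F (ProbabilityTheory.Kernel.comp (fiberKernel hkn q)
      (ProbabilityTheory.Kernel.const Unit (grassmannMeasure hkn)) ()) := by
    rw [← Measure.comp_eq_comp_const_apply]
    rw [hvol] at hF
    exact (integrable_smul_measure hC0 hC).mp hF
  have hae := hcomp.ae_of_comp
  have hint := hcomp.integral_comp
  have heq := ProbabilityTheory.Kernel.integral_comp hcomp
  simp only [ProbabilityTheory.Kernel.const_apply, fiberKernel_apply, integral_fiberMeasure,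
    integrable_fiberMeasure_iff] at hae hint heq
  refine ⟨hae, hint, ?_⟩
  rw [← heq, ← Measure.comp_eq_comp_const_apply, hvol, integral_smul_measure, hCσ,
    RCLike.real_smul_eq_coe_mul]
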